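/- Let $d\ge 2$ be an even integer. Write vectors of $\mathbb R^{d+1}$ as $\binom{x_0}{x}$ with $x_0\in\mathbb R$, $x\in\mathbb R^d$, let $e_0,\dots,e_d$ be the unit vectors, and let $e\in\mathbb R^d$ be the all-ones vector. Let $Q\subseteq\mathbb R^{d+1}$ be the cone generated by all $0$-$1$ vectors with $x_0=1$, and for a cone $L\subseteq\mathbb R^{d+1}$ let $L^*=\{s: s^Ty\ge 0\ \forall y\in L\}$ and let $L_I$ be the cone generated by the $0$-$1$ vectors of $L$ with $x_0=1$. Let $M(L)$ be the set of real symmetric $(d+1)\times(d+1)$ matrices $Y$ with $Ye_0=\mathrm{diag}(Y)$ and $u^TYv\ge 0$ for all $u\in Q^*$, $v\in L^*$; let $M_+(L)$ be the set of positive semidefinite $Y\in M(L)$. Put $N(L)=\{\mathrm{diag}(Y):Y\in M(L)\}$, $N_+(L)=\{\mathrm{diag}(Y):Y\in M_+(L)\}$, and let $N^r$, $N_+^r$ be the $r$-fold iterates ($N^0(L)=N_+^0(L)=L$). For an inequality $a^Tx\le\alpha x_0$ that is valid for $L_I$, its $N$-rank (resp. $N_+$-rank) relative to $L$ is the smallest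 integer $r\ge 0$ such that it is valid for $N^r(L)$ (resp. $N_+^r(L)$). Let $$K=\Big\{\tbinom{x_0}{x}\in\mathbb R^{d+1}:\ \sum_{i\in S}x_i\le \tfrac d2 x_0\ \text{ for all } S\subseteq\{1,\dots,d\} \text{ with } |S|=\tfrac d2+1,\quad 0\le x\le x_0e\Big\}.$$ Then the inequality $\sum_{i=1}^d x_i\le \frac d2x_0$ is valid for $K_I$, and: 1. its $N$-rank relative to $K$ is $d-2$; 2. if $d\ge 4$, its $N_+$-rank relative to $K$ is $\frac d2$; 3. for every integer $r\ge 0$ with $r\le \frac d2-\sqrt d+\frac32$, the maxima $$\max\{e^Tx:\ \tbinom1x\in N^r(K)\}\quad\text{and}\quad \max\{e^Tx:\ \tbinom1x\in N_+^r(K)\}$$ are attained and equal. -/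

import Mathlib

open scoped Matrix

namespace LiftProject

noncomputable section

/-! Vectors of `ℝ^{d+1}` are functions `x : Fin (d + 1) → ℝ`; `x 0` is the homogenizing coordinate
`x₀`, and `x i.succ` for `i : Fin d` are the `d` remaining coordinates. -/

variable {d : ℕ}

/-- The `0`-`1` vectors of `ℝ^{d+1}` with `x₀ = 1`. -/
def zeroOneVectors (d : ℕ) : Set (Fin (d + 1) → ℝ) :=
  {x | x 0 = 1 ∧ ∀ i : Fin d, x i.succ = 0 ∨ x i.succ = 1}

/-- The cone `Q` generated by all `0`-`1` vectors with `x₀ = 1`. -/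
def cubeCone (d : ℕ) : Set (Fin (d + 1) → ℝ) :=
  (PointedCone.hull ℝ (zeroOneVectors d) : Set (Fin (d + 1) → ℝ))

/-- The cone `K_I` generated by all `0`-`1` vectors (with `x₀ = 1`) of `K`. -/
def integerCone (K : Set (Fin (d + 1) → ℝ)) : Set (Fin (d + 1) → ℝ) :=
  (PointedCone.hull ℝ (K ∩ zeroOneVectors d) : Set (Fin (d + 1) → ℝ))

/-- The dual cone `K* = {s : xᵀ s ≥ 0 for all x ∈ K}` for the standard inner product. -/
def dualCone (K : Set (Fin (d + 1) → ℝ)) : Set (Fin (d + 1) → ℝ) :=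
  (PointedCone.dual (dotProductBilin ℝ ℝ) K : Set (Fin (d + 1) → ℝ))

/-- `M(K)`: the symmetric matrices `Y` with `Y e₀ = diag Y` and `uᵀ Y v ≥ 0` for all `u ∈ Q*`,
`v ∈ K*`. -/
def M (K : Set (Fin (d + 1) → ℝ)) : Set (Matrix (Fin (d + 1)) (Fin (d + 1)) ℝ) :=
  {Y | Y.IsSymm ∧ Y *ᵥ Pi.single 0 1 = Y.diag ∧
    ∀ u ∈ dualCone (cubeCone d), ∀ v ∈ dualCone K, 0 ≤ u ⬝ᵥ (Y *ᵥ v)}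

/-- `M₊(K)`: the positive semidefinite members of `M(K)`. -/
def MPlus (K : Set (Fin (d + 1) → ℝ)) : Set (Matrix (Fin (d + 1)) (Fin (d + 1)) ℝ) :=
  {Y | Y ∈ M K ∧ Y.PosSemidef}

/-- `N(K) = {diag Y : Y ∈ M(K)}`. -/
def N (K : Set (Fin (d + 1) → ℝ)) : Set (Fin (d + 1) → ℝ) :=
  Matrix.diag '' M K

/-- `N₊(K) = {diag Y : Y ∈ M₊(K)}`. -/
def NPlus (K : Set (Fin (d + 1) → ℝ)) : Set (Fin (d + 1) → ℝ) :=
  Matrix.diag '' MPlus K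

/-- The iterate `N^r(K)`: `N⁰(K) = K` and `N^{r+1}(K) = N(N^r(K))`. -/
def NIter : ℕ → Set (Fin (d + 1) → ℝ) → Set (Fin (d + 1) → ℝ)
  | 0, K => K
  | r + 1, K => N (NIter r K)

/-- The iterate `N₊^r(K)`: `N₊⁰(K) = K` and `N₊^{r+1}(K) = N₊(N₊^r(K))`. -/
def NPlusIter : ℕ → Set (Fin (d + 1) → ℝ) → Set (Fin (d + 1) → ℝ)
  | 0, K => K
  | r + 1, K => NPlus (NPlusIter r K)

/-- The inequality `aᵀ x ≤ α x₀` is valid for `K`. -/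
def Valid (K : Set (Fin (d + 1) → ℝ)) (a : Fin d → ℝ) (α : ℝ) : Prop :=
  ∀ x ∈ K, ∑ i : Fin d, a i * x i.succ ≤ α * x 0

/-- `aᵀ x ≤ α x₀` is valid for `K_I` and its `N`-rank relative to `K` is `r`: `r` is the smallest
natural number such that the inequality is valid for `N^r(K)`. -/
def HasNRank (K : Set (Fin (d + 1) → ℝ)) (a : Fin d → ℝ) (α : ℝ) (r : ℕ) : Prop :=
  Valid (integerCone K) a α ∧ IsLeast {k : ℕ | Valid (NIter k K) a α} r

/-- `aᵀ x ≤ α x₀` is valid for `K_I` and its `N₊`-rank relative to `K` is `r`: `r` is the smallest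
natural number such that the inequality is valid for `N₊^r(K)`. -/
def HasNPlusRank (K : Set (Fin (d + 1) → ℝ)) (a : Fin d → ℝ) (α : ℝ) (r : ℕ) : Prop :=
  Valid (integerCone K) a α ∧ IsLeast {k : ℕ | Valid (NPlusIter k K) a α} r

/-- The values `eᵀ x` of the points `x ∈ ℝ^d` with `(1, x) ∈ K`. -/
def sumValues (K : Set (Fin (d + 1) → ℝ)) : Set ℝ :=
  {t | ∃ x ∈ K, x 0 = 1 ∧ t = ∑ i : Fin d, x i.succ}

/-- For even `d`, the cone `K` given by `x(S) ≤ (d/2) x₀` for all `S` with `|S| = d/2 + 1`, and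
`0 ≤ x ≤ x₀ e`. -/
def halfCone (d : ℕ) : Set (Fin (d + 1) → ℝ) :=
  {x | (∀ S : Finset (Fin d), S.card = d / 2 + 1 → ∑ i ∈ S, x i.succ ≤ (d : ℝ) / 2 * x 0) ∧
    ∀ i : Fin d, 0 ≤ x i.succ ∧ x i.succ ≤ x 0}

end

end LiftProject

/-! Put `h = d/2`. Symmetry reduces the problem to a single number per face: fix the coordinates in
`A` to one and those in `B` to zero, leaving `m` free coordinates and capacity `k = h - |A|`. After
`r` rounds the free sum on the face is at most `m` times `value psd r m k`, and when `A` and `B` are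
disjoint and `R` is all the rest, the constant vector with that entry is feasible.

One round ties three such numbers together. Column `i` of a lifting matrix lies on the face with
`x_i` fixed to one, whose value is `a` (one free coordinate and one unit of capacity fewer); the
complementary column lies on the face with `x_i` fixed to zero, whose value is `b`. Summing over `i`
gives `c (1 - a) ≤ (1 - c) b`. Semidefiniteness, tested on `t e₀ + χ_R`, adds `(m + 1) c ≤ 1 + m a`
for `m + 1` free coordinates. A matrix with constant off-diagonal entries on the free block attains
both bounds (`face_sum_le`, `facePoint_mem_liftIter`).

The rest is analysis of the recursion. The integral values `k / m` are a fixed pattern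
(`stepValue_ratio`). Without semidefiniteness, strict excess over them survives until two free
coordinates remain, giving rank `d - 2`; with it, every round uses up one unit of capacity, giving
rank `h`. For the last claim the first bound has a closed form in matching numbers of complete
bipartite graphs; it shows `m (b - a) ≤ 1` in the stated range, which is what makes the semidefinite
bound redundant. -/

namespace LiftProject

/-! ### Lift operators on closed cones inside the cube cone -/

section LiftOperators

variable {d : ℕ}

/-- A closed convex cone all of whose members satisfy `0 ≤ x ≤ x₀ e`. -/
structure IsBoxCone (K : Set (Fin (d + 1) → ℝ)) : Prop where
  isClosed : IsClosed K
  zero_mem : 0 ∈ K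
  add_mem : ∀ {x y}, x ∈ K → y ∈ K → x + y ∈ K
  smul_mem : ∀ {t : ℝ} {x}, 0 ≤ t → x ∈ K → t • x ∈ K
  box : ∀ {x}, x ∈ K → ∀ p, 0 ≤ x p ∧ x p ≤ x 0

theorem mem_dualCone {K : Set (Fin (d + 1) → ℝ)} {v : Fin (d + 1) → ℝ} :
    v ∈ dualCone K ↔ ∀ x ∈ K, 0 ≤ x ⬝ᵥ v := Iff.rfl

/-- Bipolar theorem: a separating functional is the dot product with a vector, which would lie in
the dual cone. -/
theorem IsBoxCone.mem_of_dual {K : Set (Fin (d + 1) → ℝ)} (hK : IsBoxCone K)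
    {x : Fin (d + 1) → ℝ} (hx : ∀ v ∈ dualCone K, 0 ≤ x ⬝ᵥ v) : x ∈ K := by
  by_contra hxK
  let C : ProperCone ℝ (Fin (d + 1) → ℝ) :=
    { carrier := K
      add_mem' := hK.add_mem
      zero_mem' := hK.zero_mem
      smul_mem' := fun t _ h => hK.smul_mem t.2 h
      isClosed' := hK.isClosed }
  obtain ⟨f, hf, hfx⟩ := C.hyperplane_separation_point (x₀ := x) hxK
  have key : ∀ y, f y = y ⬝ᵥ (dotProductEquiv ℝ (Fin (d + 1))).symm f.toLinearMap := by
    intro y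
    have := LinearMap.congr_fun
      ((dotProductEquiv ℝ (Fin (d + 1))).apply_symm_apply f.toLinearMap) y
    rw [dotProduct_comm]
    exact this.symm
  have := hx ((dotProductEquiv ℝ (Fin (d + 1))).symm f.toLinearMap)
    (mem_dualCone.2 fun y hy => key y ▸ hf y hy)
  rw [← key] at this
  exact absurd hfx (not_lt.2 this)

theorem cubeCone_box {x : Fin (d + 1) → ℝ} (hx : x ∈ cubeCone d) (p : Fin (d + 1)) :
    0 ≤ x p ∧ x p ≤ x 0 := by
  refine Submodule.span_induction (p := fun x _ => 0 ≤ x p ∧ x p ≤ x 0) ?_ ?_ ?_ ?_ hx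
  · rintro z ⟨h0, h1⟩
    refine Fin.cases ?_ (fun i => ?_) p
    · simp [h0]
    · rcases h1 i with h | h <;> simp [h, h0]
  · simp
  · rintro y z - - ⟨h1, h2⟩ ⟨h3, h4⟩
    exact ⟨add_nonneg h1 h3, add_le_add h2 h4⟩
  · rintro t y - ⟨h1, h2⟩
    exact ⟨mul_nonneg t.2 h1, mul_le_mul_of_nonneg_left h2 t.2⟩

/-- Membership in `M K` in terms of the columns of the matrix. -/
theorem mem_M_iff {K : Set (Fin (d + 1) → ℝ)} (hK : IsBoxCone K)
    {Y : Matrix (Fin (d + 1)) (Fin (d + 1)) ℝ} :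
    Y ∈ M K ↔ (∀ p q, Y p q = Y q p) ∧ (∀ p, Y p 0 = Y p p) ∧ (∀ p, (fun q => Y q p) ∈ K) ∧
      ∀ p, (fun q => Y q 0 - Y q p) ∈ K := by
  have hdiag : Y *ᵥ Pi.single 0 1 = Y.diag ↔ ∀ p, Y p 0 = Y p p := by
    simp [funext_iff]
  have hmul : ∀ u : Fin (d + 1) → ℝ, ∀ v, Y.IsSymm → u ⬝ᵥ (Y *ᵥ v) = (Y *ᵥ u) ⬝ᵥ v := by
    intro u v h
    rw [Matrix.dotProduct_mulVec, ← Matrix.mulVec_transpose, h.eq]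
  constructor
  · rintro ⟨hs, hd, hY⟩
    have hcol : ∀ u ∈ dualCone (cubeCone d), Y *ᵥ u ∈ K := fun u hu =>
      hK.mem_of_dual fun v hv => by rw [← hmul u v hs]; exact hY u hu v hv
    -- The vectors `e_p` and `e_0 - e_p` lie in `Q*`; they produce the two families of columns.
    refine ⟨fun p q => hs.apply q p, hdiag.1 hd, fun p => ?_, fun p => ?_⟩
    · have := hcol (Pi.single p 1)
        (mem_dualCone.2 fun x hx => by simpa using (cubeCone_box hx p).1)
      rwa [Matrix.mulVec_single_one] at this
    · have := hcol (Pi.single 0 1 - Pi.single p 1)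
        (mem_dualCone.2 fun x hx => by simpa [dotProduct_sub] using (cubeCone_box hx p).2)
      rwa [Matrix.mulVec_sub, Matrix.mulVec_single_one, Matrix.mulVec_single_one] at this
  · rintro ⟨hs, hd, hc, hc'⟩
    refine ⟨Matrix.IsSymm.ext fun p q => hs q p, hdiag.2 hd, fun u hu v hv => ?_⟩
    have h1 : ∀ p, 0 ≤ (Y *ᵥ v) p := fun p => by
      have := mem_dualCone.1 hv _ (hc p)
      have e : (fun q => Y q p) = Y p := funext fun q => hs q p
      rwa [e] at this
    have h2 : ∀ p, (Y *ᵥ v) p ≤ (Y *ᵥ v) 0 := fun p => by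
      have := mem_dualCone.1 hv _ (hc' p)
      have e : (fun q => Y q 0 - Y q p) = Y 0 - Y p := funext fun q => by
        rw [hs q p, hs q 0]; rfl
      rw [e, sub_dotProduct] at this
      exact sub_nonneg.1 this
    set w := Y *ᵥ v
    -- This vertex of the cube minimizes `u`. Since `0 ≤ w p ≤ w 0`, the product `u ⬝ᵥ w` is at
    -- least `w 0` times that minimum.
    have hz : (Fin.cons 1 (fun i : Fin d => if u i.succ < 0 then 1 else 0) : Fin (d + 1) → ℝ)
        ∈ cubeCone d := by
      apply Submodule.subset_span
      refine ⟨rfl, fun i => ?_⟩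
      simp only [Fin.cons_succ]
      split_ifs <;> simp
    have h3 := mem_dualCone.1 hu _ hz
    simp only [dotProduct, Fin.sum_univ_succ, Fin.cons_zero, Fin.cons_succ] at h3 ⊢
    have h4 : ∑ i : Fin d, ((if u i.succ < 0 then 1 else 0) * u i.succ) * w 0
        ≤ ∑ i : Fin d, u i.succ * w i.succ := by
      refine Finset.sum_le_sum fun i _ => ?_
      split_ifs with h
      · rw [one_mul]
        exact mul_le_mul_of_nonpos_left (h2 _) h.le
      · rw [zero_mul, zero_mul]
        exact mul_nonneg (not_lt.1 h) (h1 _)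
    rw [← Finset.sum_mul] at h4
    have := mul_nonneg h3 (h1 0)
    linarith

/-- The operator `N` (`psd = false`) or `N₊` (`psd = true`). -/
def lift (psd : Bool) (K : Set (Fin (d + 1) → ℝ)) : Set (Fin (d + 1) → ℝ) :=
  Matrix.diag '' {Y | Y ∈ M K ∧ (psd = true → Y.PosSemidef)}

/-- The iterates of `lift psd`. -/
def liftIter (psd : Bool) : ℕ → Set (Fin (d + 1) → ℝ) → Set (Fin (d + 1) → ℝ)
  | 0, K => K
  | r + 1, K => lift psd (liftIter psd r K)

theorem NIter_eq_liftIter (r : ℕ) (K : Set (Fin (d + 1) → ℝ)) :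
    NIter r K = liftIter false r K := by
  induction r with
  | zero => rfl
  | succ r ih => simp [NIter, liftIter, ih, N, lift]

theorem NPlusIter_eq_liftIter (r : ℕ) (K : Set (Fin (d + 1) → ℝ)) :
    NPlusIter r K = liftIter true r K := by
  induction r with
  | zero => rfl
  | succ r ih => simp [NPlusIter, liftIter, ih, NPlus, MPlus, lift]

theorem mem_lift_iff {psd : Bool} {K : Set (Fin (d + 1) → ℝ)} (hK : IsBoxCone K)
    {x : Fin (d + 1) → ℝ} :
    x ∈ lift psd K ↔ ∃ Y : Matrix (Fin (d + 1)) (Fin (d + 1)) ℝ,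
      (∀ p q, Y p q = Y q p) ∧ (∀ p, Y p 0 = x p) ∧ (∀ p, Y p p = x p) ∧
      (∀ p, (fun q => Y q p) ∈ K) ∧ (∀ p, (fun q => x q - Y q p) ∈ K) ∧
      (psd = true → Y.PosSemidef) := by
  constructor
  · rintro ⟨Y, ⟨hY, hp⟩, rfl⟩
    obtain ⟨h1, h2, h3, h4⟩ := (mem_M_iff hK).1 hY
    refine ⟨Y, h1, h2, fun _ => rfl, h3, fun p => ?_, hp⟩
    simpa [h2] using h4 p
  · rintro ⟨Y, h1, h2, h3, h4, h5, hp⟩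
    refine ⟨Y, ⟨(mem_M_iff hK).2 ⟨h1, fun p => by rw [h2, h3], h4, ?_⟩, hp⟩, funext h3⟩
    simpa [h2] using h5

theorem lift_subset {psd : Bool} {K : Set (Fin (d + 1) → ℝ)} (hK : IsBoxCone K) :
    lift psd K ⊆ K := by
  intro x hx
  obtain ⟨Y, -, h2, -, h4, -⟩ := (mem_lift_iff hK).1 hx
  simpa [h2] using h4 0

theorem isClosed_setOf_mem_M {K : Set (Fin (d + 1) → ℝ)} (hK : IsBoxCone K) (psd : Bool) :
    IsClosed {Y | Y ∈ M K ∧ (psd = true → Y.PosSemidef)} := by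
  have hcont : ∀ p q, Continuous fun Y : Matrix (Fin (d + 1)) (Fin (d + 1)) ℝ => Y p q :=
    fun p q => (continuous_apply q).comp (continuous_apply p)
  have e : {Y | Y ∈ M K ∧ (psd = true → Y.PosSemidef)} =
      {Y : Matrix (Fin (d + 1)) (Fin (d + 1)) ℝ | ((∀ p q, Y p q = Y q p) ∧
        (∀ p, Y p 0 = Y p p) ∧ (∀ p, (fun q => Y q p) ∈ K) ∧
        ∀ p, (fun q => Y q 0 - Y q p) ∈ K) ∧
        (psd = true → ∀ w : Fin (d + 1) → ℝ, 0 ≤ w ⬝ᵥ (Y *ᵥ w))} := by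
    ext Y
    simp only [Set.mem_ofPred_eq, mem_M_iff hK]
    refine and_congr_right fun h => imp_congr_right fun _ => ?_
    rw [Matrix.posSemidef_iff_dotProduct_mulVec]
    refine ⟨fun h' w => by simpa using h'.2 w, fun h' => ⟨?_, fun w => by simpa using h' w⟩⟩
    exact Matrix.IsHermitian.ext fun p q => by simpa using h.1 q p
  rw [e]
  simp only [Set.ofPred_and, Set.ofPred_forall]
  refine ((isClosed_iInter fun p => isClosed_iInter fun q => isClosed_eq (hcont _ _)
    (hcont _ _)).inter ((isClosed_iInter fun p => isClosed_eq (hcont _ _) (hcont _ _)).inter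
    ((isClosed_iInter fun p => ?_).inter (isClosed_iInter fun p => ?_)))).inter
    (isClosed_iInter fun _ => isClosed_iInter fun w => isClosed_le continuous_const ?_)
  · exact hK.isClosed.preimage (continuous_pi fun q => hcont q p)
  · exact hK.isClosed.preimage (continuous_pi fun q => (hcont q 0).sub (hcont q p))
  · fun_prop

/-- A linear image of a closed cone need not be closed. Here a convergent sequence of diagonals has
bounded `x 0`, which bounds all entries of the lifting matrices, so compactness applies. -/
theorem isClosed_lift {psd : Bool} {K : Set (Fin (d + 1) → ℝ)} (hK : IsBoxCone K) :
    IsClosed (lift psd K) := by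
  refine IsSeqClosed.isClosed fun xs x hxs hlim => ?_
  obtain ⟨R, hR⟩ := (((continuous_apply 0).tendsto x).comp hlim).bddAbove_range
  let B : Set (Matrix (Fin (d + 1)) (Fin (d + 1)) ℝ) :=
    Set.univ.pi fun _ => Set.univ.pi fun _ => Set.Icc 0 R
  have hB : IsCompact B := isCompact_univ_pi fun _ => isCompact_univ_pi fun _ => isCompact_Icc
  have himg := ((hB.inter_right (isClosed_setOf_mem_M hK psd)).image
    (f := Matrix.diag) (by fun_prop)).isClosed
  refine Set.image_mono Set.inter_subset_right
    (himg.mem_of_tendsto hlim (Filter.Eventually.of_forall fun n => ?_))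
  obtain ⟨Y, hY, hYx⟩ := hxs n
  refine ⟨Y, ⟨fun p _ q _ => ?_, hY⟩, hYx⟩
  obtain ⟨h1, h2, h3, -⟩ := (mem_M_iff hK).1 hY.1
  have hp := hK.box (h3 q) p
  have hq := hK.box (h3 0) q
  have h0 : Y 0 0 ≤ R := by
    have := hR ⟨n, rfl⟩
    rwa [Function.comp_apply, ← hYx] at this
  refine ⟨hp.1, hp.2.trans ?_⟩
  rw [h1]
  exact hq.2.trans h0

theorem IsBoxCone.lift {psd : Bool} {K : Set (Fin (d + 1) → ℝ)} (hK : IsBoxCone K) :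
    IsBoxCone (lift psd K) where
  isClosed := isClosed_lift hK
  zero_mem := (mem_lift_iff hK).2 ⟨0, by simp, by simp, by simp, fun _ => hK.zero_mem,
    fun _ => by simpa using! hK.zero_mem, fun _ => Matrix.PosSemidef.zero⟩
  add_mem := by
    intro x y hx hy
    obtain ⟨Y, a1, a2, a3, a4, a5, a6⟩ := (mem_lift_iff hK).1 hx
    obtain ⟨Z, b1, b2, b3, b4, b5, b6⟩ := (mem_lift_iff hK).1 hy
    refine (mem_lift_iff hK).2 ⟨Y + Z, fun p q => ?_, fun p => ?_, fun p => ?_, fun p => ?_,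
      fun p => ?_, fun h => (a6 h).add (b6 h)⟩
    · simp [a1 p q, b1 p q]
    · simp [a2, b2]
    · simp [a3, b3]
    · exact hK.add_mem (a4 p) (b4 p)
    · convert hK.add_mem (a5 p) (b5 p) using 1
      ext q
      simp only [Pi.add_apply, Matrix.add_apply]
      ring
  smul_mem := by
    intro t x ht hx
    obtain ⟨Y, a1, a2, a3, a4, a5, a6⟩ := (mem_lift_iff hK).1 hx
    refine (mem_lift_iff hK).2 ⟨t • Y, fun p q => ?_, fun p => ?_, fun p => ?_, fun p => ?_,
      fun p => ?_, fun h => (a6 h).smul ht⟩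
    · simp [a1 p q]
    · simp [a2]
    · simp [a3]
    · exact hK.smul_mem ht (a4 p)
    · convert hK.smul_mem ht (a5 p) using 1
      ext q
      simp only [Pi.smul_apply, Matrix.smul_apply, smul_eq_mul]
      ring
  box := fun hx => hK.box (lift_subset hK hx)

theorem IsBoxCone.liftIter {psd : Bool} {K : Set (Fin (d + 1) → ℝ)} (hK : IsBoxCone K) (r : ℕ) :
    IsBoxCone (liftIter psd r K) := by
  induction r with
  | zero => exact hK
  | succ r ih => exact ih.lift

theorem liftIter_subset {psd : Bool} {K : Set (Fin (d + 1) → ℝ)} (hK : IsBoxCone K) (r : ℕ) :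
    liftIter psd r K ⊆ K := by
  induction r with
  | zero => exact subset_rfl
  | succ r ih => exact (lift_subset (hK.liftIter r)).trans ih

end LiftOperators

/-! ### The optimal values and their recursion -/

section Value

/-- One step of the recursion for the largest constant vector on a face. -/
noncomputable def stepValue (psd : Bool) (m : ℕ) (a b : ℝ) : ℝ :=
  -- The first bound solves `c (1 - a) = (1 - c) b`, the second `(m + 1) c = 1 + m a`.
  if psd then min (b / (1 - a + b)) ((1 + m * a) / (m + 1)) else b / (1 - a + b)

/-- The largest `c` such that, after `r` rounds, the constant vector `c e` on `m` free coordinates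
with remaining capacity `k` is feasible. -/
noncomputable def value (psd : Bool) : ℕ → ℕ → ℕ → ℝ
  | _, 0, _ => 1
  | _, _ + 1, 0 => 0
  -- There are `m + 1` free coordinates and capacity `k + 1`: either no constraint is active, or `k
  -- + 2` equal entries sum to at most `k + 1`.
  | 0, m + 1, k + 1 => if m ≤ k then 1 else (k + 1) / (k + 2)
  | r + 1, m + 1, k + 1 => stepValue psd m (value psd r m k) (value psd r m (k + 1))

variable {psd : Bool}

@[simp] theorem value_zero_free (r k : ℕ) : value psd r 0 k = 1 := by
  cases r <;> cases k <;> simp [value]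

@[simp] theorem value_zero_capacity (r m : ℕ) : value psd r (m + 1) 0 = 0 := by
  cases r <;> simp [value]

theorem value_zero_round (m k : ℕ) :
    value psd 0 (m + 1) (k + 1) = if m ≤ k then 1 else ((k : ℝ) + 1) / (k + 2) := by
  simp [value]

theorem value_succ (r m k : ℕ) : value psd (r + 1) (m + 1) (k + 1) =
    stepValue psd m (value psd r m k) (value psd r m (k + 1)) := by
  simp [value]

theorem stepValue_le_div (m : ℕ) (a b : ℝ) : stepValue psd m a b ≤ b / (1 - a + b) := by
  unfold stepValue
  split_ifs
  · exact min_le_left _ _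
  · exact le_rfl

theorem stepValue_mono {m : ℕ} {a b a' b' : ℝ} (ha' : a' ≤ 1) (hb : 0 ≤ b)
    (hab : a ≤ b) (hab' : a' ≤ b') (haa : a ≤ a') (hbb : b ≤ b') :
    stepValue psd m a b ≤ stepValue psd m a' b' := by
  have h1 : b / (1 - a + b) ≤ b' / (1 - a' + b') := by
    rw [div_le_div_iff₀ (by linarith) (by linarith)]
    nlinarith [mul_le_mul hbb (sub_le_sub_left haa 1) (by linarith) (by linarith)]
  have h2 : (1 + m * a) / (m + 1) ≤ (1 + m * a') / (m + 1) := by gcongr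
  unfold stepValue
  split_ifs
  · exact min_le_min h1 h2
  · exact h1

theorem stepValue_mem {m : ℕ} {a b : ℝ} (ha : 0 ≤ a) (ha1 : a ≤ 1) (hb : 0 ≤ b) (hab : a ≤ b) :
    0 ≤ stepValue psd m a b ∧ stepValue psd m a b ≤ 1 := by
  have h0 : 0 ≤ b / (1 - a + b) := div_nonneg hb (by linarith)
  refine ⟨?_, (stepValue_le_div m a b).trans ?_⟩
  · unfold stepValue
    split_ifs
    · exact le_min h0 (by positivity)
    · exact h0
  · rw [div_le_one (by linarith)]
    linarith

/-- The three bounds are proved together: monotonicity in `k` keeps the denominator `1 - a + b` at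
least one, and is itself inherited through `stepValue_mono`. -/
theorem value_bounds (r m k : ℕ) : 0 ≤ value psd r m k ∧ value psd r m k ≤ 1 ∧
    value psd r m k ≤ value psd r m (k + 1) := by
  induction r generalizing m k with
  | zero =>
    rcases m with _ | m
    · simp
    · have key : ∀ k, 0 ≤ value psd 0 (m + 1) k ∧ value psd 0 (m + 1) k ≤ 1 := by
        rintro (_ | k)
        · simp
        · rw [value_zero_round]
          split_ifs
          · simp
          · refine ⟨by positivity, ?_⟩
            rw [div_le_one (by positivity)]
            linarith
      refine ⟨(key k).1, (key k).2, ?_⟩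
      rcases k with _ | k
      · simpa using (key 1).1
      · rw [value_zero_round, value_zero_round]
        split_ifs with h1 h2 h2
        · exact le_rfl
        · omega
        · rw [div_le_one (by positivity)]
          linarith
        · push_cast
          rw [div_le_div_iff₀ (by positivity) (by positivity)]
          nlinarith
  | succ r ih =>
    rcases m with _ | m
    · simp
    · rcases k with _ | k
      · simp only [value_zero_capacity, value_succ]
        exact ⟨le_rfl, zero_le_one, (stepValue_mem (ih _ _).1 (ih _ _).2.1 (ih _ _).1
          (ih _ _).2.2).1⟩
      · rw [value_succ, value_succ]
        obtain ⟨h1, h2⟩ := stepValue_mem (psd := psd) (m := m) (ih m k).1 (ih m k).2.1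
          (ih m (k + 1)).1 (ih m k).2.2
        exact ⟨h1, h2, stepValue_mono (ih _ _).2.1 (ih _ _).1 (ih _ _).2.2 (ih _ _).2.2
          (ih _ _).2.2 (ih _ _).2.2⟩

theorem value_nonneg (r m k : ℕ) : 0 ≤ value psd r m k := (value_bounds r m k).1
theorem value_le_one (r m k : ℕ) : value psd r m k ≤ 1 := (value_bounds r m k).2.1
theorem value_le_succ (r m k : ℕ) : value psd r m k ≤ value psd r m (k + 1) :=
  (value_bounds r m k).2.2

theorem value_eq_one {r m k : ℕ} (h : m ≤ k) : value psd r m k = 1 := by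
  induction r generalizing m k with
  | zero =>
    rcases m with _ | m
    · simp
    · obtain ⟨k, rfl⟩ : ∃ l, k = l + 1 := ⟨k - 1, by omega⟩
      rw [value_zero_round, if_pos (by omega)]
  | succ r ih =>
    rcases m with _ | m
    · simp
    · obtain ⟨k, rfl⟩ : ∃ l, k = l + 1 := ⟨k - 1, by omega⟩
      rw [value_succ, ih (by omega), ih (by omega)]
      have : (1 + (m : ℝ)) / (m + 1) = 1 := by rw [add_comm]; exact div_self (by positivity)
      simp [stepValue, this]

/-- On integral values the two bounds coincide, so a step reproduces the integral value. -/
theorem stepValue_ratio {m k : ℕ} (hm : 0 < m) :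
    stepValue psd m ((k : ℝ) / m) ((k + 1 : ℝ) / m) = (k + 1) / (m + 1) := by
  have hm' : (0 : ℝ) < m := by exact_mod_cast hm
  have h1 : ((k + 1 : ℝ) / m) / (1 - (k : ℝ) / m + (k + 1 : ℝ) / m) = (k + 1) / (m + 1) := by
    have : 1 - (k : ℝ) / m + (k + 1 : ℝ) / m = (m + 1) / m := by field_simp; ring
    rw [this]
    field_simp
  have h2 : (1 + m * ((k : ℝ) / m)) / (m + 1) = (k + 1) / (m + 1) := by
    rw [mul_div_cancel₀ _ hm'.ne', add_comm]
  unfold stepValue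
  rw [h1, h2]
  simp

theorem ratio_le_value {r m k : ℕ} (h : k ≤ m) : (k : ℝ) / m ≤ value psd r m k := by
  induction r generalizing m k with
  | zero =>
    rcases m with _ | m
    · simp
    · rcases k with _ | k
      · simp
      · rw [value_zero_round]
        push_cast
        split_ifs with h1
        · rw [div_le_one (by positivity)]
          exact_mod_cast h
        · have : (k : ℝ) + 1 ≤ m := by exact_mod_cast (by omega : k + 1 ≤ m)
          exact div_le_div_of_nonneg_left (by positivity) (by positivity) (by linarith)
  | succ r ih =>
    rcases m with _ | m
    · simp
    · rcases k with _ | k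
      · simp
      · rcases Nat.eq_or_lt_of_le (by omega : k ≤ m) with rfl | hlt
        · rw [value_eq_one le_rfl]
          exact div_self_le_one _
        · have hm' : (0 : ℝ) < m := by exact_mod_cast (by omega : 0 < m)
          rw [value_succ]
          push_cast
          rw [← stepValue_ratio (psd := psd) (by omega : 0 < m)]
          have h2 := ih (m := m) (k := k + 1) (by omega)
          push_cast at h2
          exact stepValue_mono (value_le_one _ _ _) (by positivity)
            (by gcongr; linarith) (value_le_succ _ _ _) (ih (by omega)) h2

/-- Strict excess in either predecessor passes to the next value; this drives both lower bounds on
the rank. -/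
theorem ratio_lt_div {m k : ℕ} {a b : ℝ} (hkm : k < m) (hk : 0 ≤ a) (ha1 : a ≤ 1) (hab : a ≤ b)
    (ha : (k : ℝ) / m ≤ a) (hb : (k + 1 : ℝ) / m ≤ b)
    (hlt : (k : ℝ) / m < a ∨ (k + 1 : ℝ) / m < b) :
    (k + 1 : ℝ) / (m + 1) < b / (1 - a + b) := by
  have hm' : (0 : ℝ) < m := by exact_mod_cast (by omega : 0 < m)
  have hkm' : (k : ℝ) + 1 ≤ m := by exact_mod_cast hkm
  rw [div_le_iff₀ hm'] at ha hb
  rw [div_lt_iff₀ hm', div_lt_iff₀ hm'] at hlt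
  rw [div_lt_div_iff₀ (by positivity) (by linarith)]
  rcases hlt with h | h
  · have : (m : ℝ) * (1 - a) < m - k := by linarith
    have hb0 : 0 < b := by nlinarith
    nlinarith [mul_lt_mul_of_pos_left this hb0]
  · rcases ha1.lt_or_eq with h1 | h1
    · have : (k + 1) * (1 - a) < (b * m) * (1 - a) := mul_lt_mul_of_pos_right h (by linarith)
      nlinarith
    · subst h1
      nlinarith

/-- Before round `m - 2` the value without semidefiniteness exceeds the integral one. -/
theorem ratio_lt_value_false {r m k : ℕ} (hk : 1 ≤ k) (hkm : k + 2 ≤ m) (hr : r + 2 < m) :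
    (k : ℝ) / m < value false r m k := by
  induction r generalizing m k with
  | zero =>
    obtain ⟨m, rfl⟩ : ∃ l, m = l + 1 := ⟨m - 1, by omega⟩
    obtain ⟨k, rfl⟩ : ∃ l, k = l + 1 := ⟨k - 1, by omega⟩
    rw [value_zero_round, if_neg (by omega)]
    push_cast
    have : (k : ℝ) + 2 ≤ m := by exact_mod_cast (by omega : k + 2 ≤ m)
    exact div_lt_div_of_pos_left (by positivity) (by positivity) (by linarith)
  | succ r ih =>
    obtain ⟨m, rfl⟩ : ∃ l, m = l + 1 := ⟨m - 1, by omega⟩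
    obtain ⟨k, rfl⟩ : ∃ l, k = l + 1 := ⟨k - 1, by omega⟩
    rw [value_succ]
    simp only [stepValue, Bool.false_eq_true, if_false]
    push_cast
    refine ratio_lt_div (by omega) (value_nonneg _ _ _) (value_le_one _ _ _) (value_le_succ _ _ _)
      (ratio_le_value (by omega)) (by exact_mod_cast ratio_le_value (k := k + 1) (by omega)) ?_
    -- Keep the capacity while it stays at least two below the number of free coordinates; otherwise
    -- `m = k + 2`, and fixing a coordinate to one preserves that margin.
    by_cases h : k + 1 + 2 ≤ m
    · right
      exact_mod_cast ih (k := k + 1) (by omega) h (by omega)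
    · left
      exact ih (by omega) (by omega) (by omega)

/-- With two free coordinates the initial cone is already exact, and every round accounts for one
more coordinate. -/
theorem value_false_eq_ratio {m k : ℕ} (h : k ≤ m + 2) :
    value false m (m + 2) k = (k : ℝ) / (m + 2) := by
  induction m generalizing k with
  | zero =>
    rcases k with _ | k
    · simp
    · rw [value_zero_round]
      push_cast
      obtain rfl | rfl : k = 0 ∨ k = 1 := by omega
      · norm_num
      · norm_num
  | succ m ih =>
    rcases k with _ | k
    · simp
    · rcases Nat.eq_or_lt_of_le h with h' | hlt
      · rw [value_eq_one h'.ge, h']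
        push_cast
        rw [div_self]
        positivity
      · rw [show m + 1 + 2 = (m + 2) + 1 from rfl, value_succ, ih (by omega), ih (by omega)]
        have := stepValue_ratio (psd := false) (m := m + 2) (k := k) (by omega)
        push_cast at this ⊢
        rw [this]
        ring

/-- Before round `k` the value with semidefiniteness exceeds the integral one. -/
theorem ratio_lt_value_true {r m k : ℕ} (hkm : k + 2 ≤ m) (hr : r < k) :
    (k : ℝ) / m < value true r m k := by
  induction r generalizing m k with
  | zero =>
    obtain ⟨m, rfl⟩ : ∃ l, m = l + 1 := ⟨m - 1, by omega⟩
    obtain ⟨k, rfl⟩ : ∃ l, k = l + 1 := ⟨k - 1, by omega⟩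
    rw [value_zero_round, if_neg (by omega)]
    push_cast
    have : (k : ℝ) + 2 ≤ m := by exact_mod_cast (by omega : k + 2 ≤ m)
    exact div_lt_div_of_pos_left (by positivity) (by positivity) (by linarith)
  | succ r ih =>
    obtain ⟨m, rfl⟩ : ∃ l, m = l + 1 := ⟨m - 1, by omega⟩
    obtain ⟨k, rfl⟩ : ∃ l, k = l + 1 := ⟨k - 1, by omega⟩
    have hlt := ih (m := m) (k := k) (by omega) (by omega)
    rw [value_succ]
    simp only [stepValue, if_true]
    push_cast
    refine lt_min (ratio_lt_div (by omega) (value_nonneg _ _ _) (value_le_one _ _ _)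
      (value_le_succ _ _ _)
      (ratio_le_value (by omega)) (by exact_mod_cast ratio_le_value (k := k + 1) (by omega))
      (Or.inl hlt)) ?_
    rw [div_lt_iff₀ (by exact_mod_cast (by omega : 0 < m))] at hlt
    rw [div_lt_div_iff_of_pos_right (by positivity)]
    linarith

/-- The semidefinite bound `(m + 1) c ≤ 1 + m a` telescopes down to capacity zero. -/
theorem value_true_le_ratio {r m k : ℕ} (h : k ≤ m) (hr : k ≤ r) :
    m * value true r m k ≤ k := by
  induction r generalizing m k with
  | zero =>
    obtain rfl : k = 0 := by omega
    rcases m with _ | m <;> simp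
  | succ r ih =>
    rcases k with _ | k
    · rcases m with _ | m <;> simp
    · obtain ⟨m, rfl⟩ : ∃ l, m = l + 1 := ⟨m - 1, by omega⟩
      have h1 := ih (m := m) (k := k) (by omega) (by omega)
      have h2 : value true (r + 1) (m + 1) (k + 1) ≤ (1 + m * value true r m k) / (m + 1) := by
        rw [value_succ]
        simp only [stepValue, if_true]
        exact min_le_right _ _
      rw [le_div_iff₀ (by positivity)] at h2
      push_cast
      linarith

/-! ### Closed form through matching numbers -/

/-- The number of matchings of the complete bipartite graph `K_{r,k}`. -/
def matchings : ℕ → ℕ → ℕ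
  | 0, _ => 1
  | _ + 1, 0 => 1
  | r + 1, k + 1 => matchings r (k + 1) + (k + 1) * matchings r k

theorem matchings_zero_right (r : ℕ) : matchings r 0 = 1 := by
  cases r <;> simp [matchings]

theorem matchings_pos (r k : ℕ) : 0 < matchings r k := by
  induction r generalizing k with
  | zero => simp [matchings]
  | succ r ih =>
    cases k with
    | zero => simp [matchings]
    | succ k => simp only [matchings]; have := ih (k + 1); omega

/-- The defining recursion removes a vertex on the left side; this removes one on the right. -/
theorem matchings_succ_right (r k : ℕ) :
    matchings (r + 1) (k + 1) = matchings (r + 1) k + (r + 1) * matchings r k := by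
  induction r generalizing k with
  | zero => cases k <;> simp [matchings]; ring
  | succ r ih =>
    cases k with
    | zero =>
      have := ih 0
      simp only [matchings, matchings_zero_right] at this ⊢
      omega
    | succ k =>
      have h1 := ih (k + 1)
      have h2 := ih k
      have h3 : matchings (r + 1) (k + 1) = matchings r (k + 1) + (k + 1) * matchings r k := rfl
      have h4 : matchings (r + 2) (k + 2)
        = matchings (r + 1) (k + 2) + (k + 2) * matchings (r + 1) (k + 1) := rfl
      have h5 : matchings (r + 2) (k + 1)
        = matchings (r + 1) (k + 1) + (k + 1) * matchings (r + 1) k := rfl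
      rw [h4, h5, h1]
      zify at *
      linear_combination (k + 1) * h2 - (r + 1) * h3

/-- Combining the left and right recursions eliminates the shift in `k`. At `s = 0` the truncated `s
- 1` is harmless because its coefficient vanishes. -/
theorem matchings_three_term (s k : ℕ) :
    matchings (s + 1) k + s * matchings s k
      = (k + 1) * matchings s k + s * matchings (s - 1) k := by
  rcases s with _ | s
  · cases k <;> simp [matchings]; ring
  · rcases k with _ | k
    · simp [matchings_zero_right]
    · have h1 : matchings (s + 2) (k + 1)
        = matchings (s + 1) (k + 1) + (k + 1) * matchings (s + 1) k := rfl
      have h2 : matchings (s + 1) (k + 1) = matchings s (k + 1) + (k + 1) * matchings s k := rfl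
      have h3 := matchings_succ_right s k
      simp only [Nat.add_sub_cancel]
      rw [h1]
      zify at *
      linear_combination (s + 1) * h2 - (k + 1) * h3

/-- As long as `r + k < m`, the value does not depend on `m`. -/
theorem value_false_eq_matchings {r m k : ℕ} (h : r + k < m) :
    value false r m k = 1 - (matchings r k : ℝ) / matchings (r + 1) k := by
  induction r generalizing m k with
  | zero =>
    obtain ⟨m, rfl⟩ : ∃ l, m = l + 1 := ⟨m - 1, by omega⟩
    rcases k with _ | k
    · simp [matchings]
    · rw [value_zero_round, if_neg (by omega)]
      simp only [matchings, mul_one]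
      push_cast
      field_simp
      ring
  | succ r ih =>
    obtain ⟨m, rfl⟩ : ∃ l, m = l + 1 := ⟨m - 1, by omega⟩
    rcases k with _ | k
    · simp [matchings_zero_right]
    · rw [value_succ, ih (by omega), ih (by omega)]
      simp only [stepValue, Bool.false_eq_true, if_false]
      have e1 : (matchings (r + 1 + 1) (k + 1) : ℝ)
          = matchings (r + 1) (k + 1) + (k + 1) * matchings (r + 1) k := by
        exact_mod_cast (rfl : matchings (r + 1 + 1) (k + 1) = _)
      have e2 : (matchings (r + 1) (k + 1) : ℝ)
          = matchings r (k + 1) + (k + 1) * matchings r k := by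
        exact_mod_cast (rfl : matchings (r + 1) (k + 1) = _)
      have p1 : (0 : ℝ) < matchings (r + 1) k := by exact_mod_cast matchings_pos _ _
      have p2 : (0 : ℝ) < matchings r (k + 1) := by exact_mod_cast matchings_pos _ _
      have p3 : (0 : ℝ) < matchings r k := by exact_mod_cast matchings_pos _ _
      have p4 : (0 : ℝ) < matchings (r + 1) (k + 1) := by exact_mod_cast matchings_pos _ _
      have p5 : (0 : ℝ) < matchings (r + 1 + 1) (k + 1) := by exact_mod_cast matchings_pos _ _
      have b1 : 1 - (matchings r (k + 1) : ℝ) / matchings (r + 1) (k + 1)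
          = (k + 1) * matchings r k / matchings (r + 1) (k + 1) := by
        rw [eq_div_iff p4.ne', sub_mul, div_mul_cancel₀ _ p4.ne', e2]
        ring
      have b2 : 1 - (matchings (r + 1) (k + 1) : ℝ) / matchings (r + 1 + 1) (k + 1)
          = (k + 1) * matchings (r + 1) k / matchings (r + 1 + 1) (k + 1) := by
        rw [eq_div_iff p5.ne', sub_mul, div_mul_cancel₀ _ p5.ne', e1]
        ring
      have b3 : 1 - (1 - (matchings r k : ℝ) / matchings (r + 1) k)
          + (k + 1) * matchings r k / matchings (r + 1) (k + 1)
          = matchings r k * matchings (r + 1 + 1) (k + 1)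
            / (matchings (r + 1) k * matchings (r + 1) (k + 1)) := by
        rw [e1]
        field_simp
        ring
      rw [b1, b2, b3]
      field_simp

theorem matchings_ratio_ge (s k : ℕ) :
    (k : ℝ) + 1 - s ≤ (matchings (s + 1) k : ℝ) / matchings s k := by
  have p : (0 : ℝ) < matchings s k := by exact_mod_cast matchings_pos _ _
  have h : (matchings (s + 1) k : ℝ) + s * matchings s k
      = (k + 1) * matchings s k + s * matchings (s - 1) k := by
    exact_mod_cast matchings_three_term s k
  rw [le_div_iff₀ p]
  have : (0 : ℝ) ≤ s * matchings (s - 1) k := by positivity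
  linarith

theorem matchings_ratio_mono (s k : ℕ) :
    (matchings s (k + 1) : ℝ) / matchings (s + 1) (k + 1)
      ≤ (matchings s k : ℝ) / matchings (s + 1) k := by
  -- The number of free coordinates is arbitrary; `s + k + 2` is large enough for the closed form at
  -- both `k` and `k + 1`.
  have := value_le_succ (psd := false) s (s + k + 2) k
  rw [value_false_eq_matchings (by omega), value_false_eq_matchings (by omega)] at this
  linarith

/-- By the three-term relation the ratio is `k + 1 - s` plus a term that does not increase with `k`.
-/
theorem matchings_ratio_succ_le (s k : ℕ) :
    (matchings (s + 1) (k + 1) : ℝ) / matchings s (k + 1)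
      ≤ (matchings (s + 1) k : ℝ) / matchings s k + 1 := by
  have key : ∀ k : ℕ, (matchings (s + 1) k : ℝ) / matchings s k
      = k + 1 - s + s * ((matchings (s - 1) k : ℝ) / matchings s k) := by
    intro k
    have p : (0 : ℝ) < matchings s k := by exact_mod_cast matchings_pos _ _
    have h : (matchings (s + 1) k : ℝ) + s * matchings s k
        = (k + 1) * matchings s k + s * matchings (s - 1) k := by
      exact_mod_cast matchings_three_term s k
    field_simp
    linarith
  rw [key, key]
  rcases s with _ | s
  · simp
  · have := mul_le_mul_of_nonneg_left (matchings_ratio_mono s k)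
      (by positivity : (0 : ℝ) ≤ (s + 1 : ℕ))
    simp only [Nat.add_sub_cancel]
    push_cast at this ⊢
    linarith

/-- With `p`, `q` the matching ratios at `k` and `k + 1`, the gap is `(q - p) / (q p)`, where `q - p
≤ 1` and `q p ≥ (k + 2 - s)(k + 1 - s)`. -/
theorem value_gap_le {s m k : ℕ} {t : ℝ} (h : s + k + 1 < m) (ht : 0 < t) (hs : s ≤ k + 1)
    (hk : t ≤ ((k : ℝ) + 2 - s) * (k + 1 - s)) :
    t * (value false s m (k + 1) - value false s m k) ≤ 1 := by
  rw [value_false_eq_matchings (by omega), value_false_eq_matchings (by omega)]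
  have hs' : (s : ℝ) ≤ k + 1 := by exact_mod_cast hs
  have p1 : (0 : ℝ) < matchings (s + 1) k := by exact_mod_cast matchings_pos _ _
  have p2 : (0 : ℝ) < matchings s (k + 1) := by exact_mod_cast matchings_pos _ _
  have p3 : (0 : ℝ) < matchings s k := by exact_mod_cast matchings_pos _ _
  have p4 : (0 : ℝ) < matchings (s + 1) (k + 1) := by exact_mod_cast matchings_pos _ _
  have h1 := matchings_ratio_ge s k
  have h2 := matchings_ratio_ge s (k + 1)
  have h3 := matchings_ratio_succ_le s k
  push_cast at h2
  rw [← inv_div (matchings (s + 1) k : ℝ), ← inv_div (matchings (s + 1) (k + 1) : ℝ)]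
  set p := (matchings (s + 1) k : ℝ) / matchings s k
  set q := (matchings (s + 1) (k + 1) : ℝ) / matchings s (k + 1)
  have hp : 0 < p := div_pos p1 p3
  have hq : 0 < q := div_pos p4 p2
  have hpq : t ≤ q * p := hk.trans (mul_le_mul (by linarith) h1 (by linarith) hq.le)
  have e : t * (1 - q⁻¹ - (1 - p⁻¹)) = t * (q - p) / (q * p) := by
    field_simp
    ring
  rw [e, div_le_one (by positivity)]
  nlinarith

/-- The hypotheses pass to both predecessors: `k - r` does not decrease and `m` drops. -/
theorem value_true_eq_false {r m k : ℕ} (h : r + k < m) (hr : r ≤ k + 1)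
    (hm : (m : ℝ) - 1 ≤ ((k : ℝ) + 2 - r) * (k + 1 - r)) :
    value true r m k = value false r m k := by
  obtain ⟨m, rfl⟩ : ∃ l, m = l + 1 := ⟨m - 1, by omega⟩
  induction r generalizing m k with
  | zero => rcases k with _ | k <;> simp [value]
  | succ r ih =>
    rcases k with _ | k
    · simp
    · obtain ⟨m, rfl⟩ : ∃ l, m = l + 1 := ⟨m - 1, by omega⟩
      have hr' : (r : ℝ) ≤ k + 1 := by exact_mod_cast (by omega : r ≤ k + 1)
      push_cast at hm
      rw [value_succ, value_succ, ih (by omega) m (by omega) (by push_cast; nlinarith),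
        ih (by omega) m (by omega) (by push_cast; nlinarith)]
      have hgap := value_gap_le (s := r) (m := m + 1) (k := k) (t := m + 1) (by omega)
        (by positivity) (by omega) (by nlinarith)
      have ha := value_le_one (psd := false) r (m + 1) k
      have hab := value_le_succ (psd := false) r (m + 1) k
      set a := value false r (m + 1) k
      set b := value false r (m + 1) (k + 1)
      simp only [stepValue, if_true, Bool.false_eq_true, if_false]
      -- With `M = m + 1`, cross-multiplying leaves `0 ≤ (1 - a) (1 - M (b - a))`, which the gap
      -- bound supplies.
      refine min_eq_left ?_
      rw [div_le_div_iff₀ (by linarith) (by positivity)]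
      push_cast
      nlinarith [mul_le_mul_of_nonneg_right hgap (sub_nonneg.2 ha)]

end Value

/-! ### Upper bounds on faces -/

section UpperBound

variable {d : ℕ}

/-- The cone given by `x(S) ≤ h x₀` for all `S` with `|S| = h + 1`, and `0 ≤ x ≤ x₀ e`. -/
def cardinalityCone (d h : ℕ) : Set (Fin (d + 1) → ℝ) :=
  {x | (∀ S : Finset (Fin d), S.card = h + 1 → ∑ i ∈ S, x i.succ ≤ (h : ℝ) * x 0) ∧
    ∀ i : Fin d, 0 ≤ x i.succ ∧ x i.succ ≤ x 0}

theorem halfCone_eq_cardinalityCone {h : ℕ} (hd : d = 2 * h) :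
    halfCone d = cardinalityCone d h := by
  have h1 : d / 2 = h := by omega
  have h2 : (d : ℝ) / 2 = h := by rw [hd]; push_cast; ring
  simp [halfCone, cardinalityCone, h1, h2]

theorem isBoxCone_cardinalityCone (hd : 0 < d) (h : ℕ) : IsBoxCone (cardinalityCone d h) where
  isClosed := by
    simp only [cardinalityCone, Set.ofPred_and, Set.ofPred_forall]
    refine (isClosed_iInter fun S => isClosed_iInter fun _ => isClosed_le ?_ ?_).inter
      (isClosed_iInter fun i => (isClosed_le ?_ ?_).inter (isClosed_le ?_ ?_)) <;> fun_prop
  zero_mem := by simp [cardinalityCone]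
  add_mem := by
    rintro x y ⟨h1, h2⟩ ⟨h3, h4⟩
    refine ⟨fun S hS => ?_, fun i => ⟨add_nonneg (h2 i).1 (h4 i).1, add_le_add (h2 i).2 (h4 i).2⟩⟩
    simp only [Pi.add_apply, Finset.sum_add_distrib, mul_add]
    exact add_le_add (h1 S hS) (h3 S hS)
  smul_mem := by
    rintro t x ht ⟨h1, h2⟩
    refine ⟨fun S hS => ?_, fun i => ⟨mul_nonneg ht (h2 i).1,
      mul_le_mul_of_nonneg_left (h2 i).2 ht⟩⟩
    simp only [Pi.smul_apply, smul_eq_mul, ← Finset.mul_sum]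
    rw [mul_left_comm]
    exact mul_le_mul_of_nonneg_left (h1 S hS) ht
  box := by
    rintro x ⟨-, h2⟩ p
    refine Fin.cases ?_ (fun i => h2 i) p
    exact ⟨(h2 ⟨0, hd⟩).1.trans (h2 ⟨0, hd⟩).2, le_rfl⟩

/-- If all `k`-element subsets have sum at most `k q`, so does every larger finite set. -/
theorem sum_le_of_forall_card_eq {ι : Type*} [DecidableEq ι] {f : ι → ℝ} {k : ℕ} (hk : 0 < k)
    {q : ℝ} {R : Finset ι} (hR : k ≤ R.card)
    (hT : ∀ T ⊆ R, T.card = k → ∑ i ∈ T, f i ≤ k * q) : ∑ i ∈ R, f i ≤ R.card * q := by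
  obtain ⟨m, hm⟩ := Nat.exists_eq_add_of_le hR
  induction m generalizing R with
  | zero => rw [hm]; exact hT R subset_rfl hm
  | succ m ih =>
    have hcard : ∀ i ∈ R, (R.erase i).card = k + m := fun i hi => by
      rw [Finset.card_erase_of_mem hi]
      omega
    -- Double counting over deletions of a single element.
    have h1 : ∑ i ∈ R, ∑ j ∈ R.erase i, f j ≤ ∑ i ∈ R, ((k + m : ℕ) : ℝ) * q :=
      Finset.sum_le_sum fun i hi => by
        have := ih (R := R.erase i) (by rw [hcard i hi]; omega)
          (fun T hTR => hT T (hTR.trans (Finset.erase_subset _ _))) (hcard i hi)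
        rwa [hcard i hi] at this
    have h2 : ∑ i ∈ R, ∑ j ∈ R.erase i, f j = ∑ i ∈ R, (∑ j ∈ R, f j - f i) :=
      Finset.sum_congr rfl fun i hi => by rw [← Finset.sum_erase_add _ _ hi]; ring
    rw [h2, Finset.sum_sub_distrib, Finset.sum_const, Finset.sum_const, hm] at h1
    have hpos : (0 : ℝ) < (k + m : ℕ) := by exact_mod_cast (by omega : 0 < k + m)
    rw [hm]
    refine le_of_mul_le_mul_left ?_ hpos
    simp only [nsmul_eq_mul] at h1
    push_cast at h1 ⊢
    linarith

/-- The inequalities obtained from a lifting matrix on a face of the cone. -/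
theorem lift_face_sum_le {psd : Bool} {K : Set (Fin (d + 1) → ℝ)} (hK : IsBoxCone K)
    {A B R : Finset (Fin d)} {a b : ℝ} {x : Fin (d + 1) → ℝ} {m : ℕ}
    (hm : R.card = m + 1)
    (hone : ∀ i ∈ R, ∀ y ∈ K, (∀ j ∈ insert i A, y j.succ = y 0) → (∀ j ∈ B, y j.succ = 0) →
      ∑ j ∈ R.erase i, y j.succ ≤ m * a * y 0)
    (hzero : ∀ i ∈ R, ∀ y ∈ K, (∀ j ∈ A, y j.succ = y 0) → (∀ j ∈ insert i B, y j.succ = 0) →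
      ∑ j ∈ R.erase i, y j.succ ≤ m * b * y 0)
    (hx : x ∈ lift psd K) (hA : ∀ j ∈ A, x j.succ = x 0) (hB : ∀ j ∈ B, x j.succ = 0) :
    m * ∑ j ∈ R, x j.succ ≤
        m * (a * ∑ j ∈ R, x j.succ + b * ((m + 1) * x 0 - ∑ j ∈ R, x j.succ)) ∧
      (psd = true → (∑ j ∈ R, x j.succ) ^ 2 ≤ x 0 * ((1 + m * a) * ∑ j ∈ R, x j.succ)) := by
  obtain ⟨Y, hs, h0, hd, hc, hc', hp⟩ := (mem_lift_iff hK).1 hx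
  -- The complementary column of `j` has leading entry `x 0 - x j.succ = 0`, so the box constraints
  -- make it vanish.
  have hYA : ∀ j ∈ A, ∀ p, Y j.succ p = Y 0 p := fun j hj p => by
    have h1 := hK.box (hc' j.succ) p
    rw [← h0 0, hs 0 j.succ, h0 j.succ, hA j hj, ← h0 0, sub_self] at h1
    rw [hs j.succ, hs 0, h0]
    linarith
  have hYB : ∀ j ∈ B, ∀ p, Y j.succ p = 0 := fun j hj p => by
    have h1 := hK.box (hc j.succ) p
    rw [hs 0 j.succ, h0, hB j hj] at h1
    rw [hs]
    linarith
  have hx0 : ∀ p, Y 0 p = x p := fun p => by rw [hs, h0]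
  have hone' : ∀ i ∈ R, ∑ j ∈ R.erase i, Y j.succ i.succ ≤ m * a * x i.succ := fun i hi => by
    have := hone i hi _ (hc i.succ) ?_ (fun j hj => hYB j hj _)
    · rwa [hx0] at this
    · intro j hj
      rcases Finset.mem_insert.1 hj with rfl | hj
      · rw [hd, hx0]
      · exact hYA j hj _
  have hzero' : ∀ i ∈ R, ∑ j ∈ R.erase i, (x j.succ - Y j.succ i.succ) ≤
      m * b * (x 0 - x i.succ) := fun i hi => by
    have := hzero i hi _ (hc' i.succ) (fun j hj => by rw [hYA j hj, hA j hj]) ?_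
    · rwa [hx0] at this
    · intro j hj
      rcases Finset.mem_insert.1 hj with rfl | hj
      · rw [hd, sub_self]
      · rw [hYB j hj, hB j hj, sub_self]
  have s1 := Finset.sum_le_sum hone'
  have s2 := Finset.sum_le_sum hzero'
  set X := ∑ j ∈ R, x j.succ with hX
  set P := ∑ i ∈ R, ∑ j ∈ R.erase i, Y j.succ i.succ with hP
  have e1 : ∑ i ∈ R, ∑ j ∈ R.erase i, (x j.succ - Y j.succ i.succ) = m * X - P := by
    simp only [Finset.sum_sub_distrib]
    congr 1
    rw [Finset.sum_congr rfl fun i hi => (Finset.sum_erase_eq_sub (f := fun j => x j.succ) hi),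
      Finset.sum_sub_distrib, Finset.sum_const, hm, nsmul_eq_mul]
    push_cast
    ring
  rw [e1, ← Finset.mul_sum, Finset.sum_sub_distrib, Finset.sum_const, hm, nsmul_eq_mul] at s2
  rw [← Finset.mul_sum] at s1
  push_cast at s2
  refine ⟨by linarith, fun h => ?_⟩
  have hq : ∀ t : ℝ, 0 ≤ t ^ 2 * x 0 + 2 * t * X + (X + P) := by
    intro t
    let w : Fin (d + 1) → ℝ := Fin.cons t fun i => if i ∈ R then 1 else 0
    have hw := (hp h).dotProduct_mulVec_nonneg w
    have e : w ⬝ᵥ (Y *ᵥ w) = t ^ 2 * x 0 + 2 * t * X + (X + P) := by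
      have e2 : X + P = ∑ i ∈ R, ∑ j ∈ R, Y i.succ j.succ := by
        rw [hX, hP, ← Finset.sum_add_distrib]
        refine Finset.sum_congr rfl fun i hi => ?_
        rw [← hd i.succ, Finset.add_sum_erase R (fun j => Y j.succ i.succ) hi]
        exact Finset.sum_congr rfl fun j _ => hs _ _
      simp only [w, dotProduct, Matrix.mulVec, Fin.sum_univ_succ, Fin.cons_zero, Fin.cons_succ,
        ite_mul, mul_ite, mul_one, one_mul, mul_zero, zero_mul, Finset.sum_ite_mem,
        Finset.univ_inter, Finset.sum_add_distrib, hx0, h0]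
      rw [e2, hX, ← Finset.sum_mul]
      ring
    rw [← e]
    simpa using hw
  have hx00 := (hK.box (lift_subset hK hx) 0).1
  have hXP : X + P ≤ (1 + m * a) * X := by linarith
  rcases hx00.eq_or_lt with hz | hpos
  · have : X = 0 := by
      rw [hX]
      refine Finset.sum_eq_zero fun j _ => ?_
      have := hK.box (lift_subset hK hx) j.succ
      linarith
    rw [this, ← hz]
    simp
  -- The minimizer of the quadratic in `t`; it gives `X ^ 2 / x 0 ≤ X + P`.
  · have h1 := hq (-X / x 0)
    have h2 : (-X / x 0) ^ 2 * x 0 + 2 * (-X / x 0) * X + (X + P) = (X + P) - X ^ 2 / x 0 := by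
      field_simp
      ring
    rw [h2, sub_nonneg, div_le_iff₀ hpos] at h1
    nlinarith

/-- If `x` equals `x₀` on `A`, then its sum over `k + 1` further coordinates is at most `k x₀`,
where `k` is the remaining capacity. -/
theorem sum_le_of_mem_liftIter {psd : Bool} {h : ℕ} (hd : 0 < d) {r : ℕ} {A T : Finset (Fin d)}
    {k : ℕ} (hdisj : Disjoint A T) (hAk : A.card + k = h) {x : Fin (d + 1) → ℝ}
    (hx : x ∈ liftIter psd r (cardinalityCone d h)) (hA : ∀ j ∈ A, x j.succ = x 0)
    (hT : T.card = k + 1) : ∑ i ∈ T, x i.succ ≤ k * x 0 := by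
  have := (liftIter_subset (isBoxCone_cardinalityCone hd h) r hx).1 (A ∪ T)
    (by rw [Finset.card_union_of_disjoint hdisj]; omega)
  rw [Finset.sum_union hdisj, Finset.sum_congr rfl hA, Finset.sum_const, nsmul_eq_mul, ← hAk]
    at this
  push_cast at this
  linarith

/-- The upper bound on faces of the iterates. -/
theorem face_sum_le {psd : Bool} {h : ℕ} (hd : 0 < d) (r : ℕ) {A B R : Finset (Fin d)}
    {m k : ℕ} (hdisj : Disjoint A R) (hR : R.card = m) (hAk : A.card + k = h)
    {x : Fin (d + 1) → ℝ} (hx : x ∈ liftIter psd r (cardinalityCone d h))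
    (hA : ∀ j ∈ A, x j.succ = x 0) (hB : ∀ j ∈ B, x j.succ = 0) :
    ∑ j ∈ R, x j.succ ≤ m * value psd r m k * x 0 := by
  induction r generalizing A B R m k x with
  | zero =>
    have hbox := (isBoxCone_cardinalityCone hd h).box hx
    rcases m with _ | m
    · simp [Finset.card_eq_zero.1 hR]
    rcases k with _ | k
    · rw [value_zero_capacity, mul_zero, zero_mul]
      refine Finset.sum_nonpos fun i hi => ?_
      simpa using sum_le_of_mem_liftIter (T := {i}) hd
        (hdisj.mono_right (by simpa using hi)) hAk hx hA rfl
    rw [value_zero_round]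
    split_ifs with hmk
    · have := Finset.sum_le_card_nsmul R (fun j => x j.succ) (x 0) fun j _ => (hbox _).2
      rwa [nsmul_eq_mul, hR, ← mul_one ((m + 1 : ℕ) : ℝ)] at this
    · have := sum_le_of_forall_card_eq (f := fun j => x j.succ) (k := k + 2) (R := R)
        (q := (k + 1) / (k + 2) * x 0) (by omega) (by omega) fun T hT hTc => by
          have := sum_le_of_mem_liftIter hd (hdisj.mono_right hT) hAk hx hA hTc
          push_cast at this ⊢
          rw [← mul_assoc, mul_div_cancel₀ _ (by positivity)]
          exact this
      rw [hR] at this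
      rwa [mul_assoc]
  | succ r ih =>
    have hK := (isBoxCone_cardinalityCone hd h).liftIter (psd := psd) r
    have hbox := hK.lift.box hx
    rcases m with _ | m
    · simp [Finset.card_eq_zero.1 hR]
    rcases k with _ | k
    · rw [value_zero_capacity, mul_zero, zero_mul]
      refine Finset.sum_nonpos fun i hi => ?_
      simpa using sum_le_of_mem_liftIter (T := {i}) hd
        (hdisj.mono_right (by simpa using hi)) hAk hx hA rfl
    -- A single free coordinate is treated apart, since the face inequality below carries a factor
    -- `m` that has to be cancelled.
    rcases Nat.eq_zero_or_pos m with rfl | hm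
    · rw [value_eq_one (by omega), mul_one]
      have := Finset.sum_le_card_nsmul R (fun j => x j.succ) (x 0) fun j _ => (hbox _).2
      rwa [nsmul_eq_mul, hR] at this
    have hmem : ∀ i ∈ R, i ∉ A := fun i hi hiA => Finset.disjoint_left.1 hdisj hiA hi
    have hcard : ∀ i ∈ R, (R.erase i).card = m := fun i hi => by
      rw [Finset.card_erase_of_mem hi, hR]
      rfl
    obtain ⟨h1, h2⟩ := lift_face_sum_le hK (A := A) (B := B)
      (a := value psd r m k) (b := value psd r m (k + 1)) hR
      (fun i hi y hy hyA hyB => ih (A := insert i A) (B := B)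
        (Finset.disjoint_insert_left.2 ⟨by simp, hdisj.mono_right (Finset.erase_subset _ _)⟩)
        (hcard i hi) (by rw [Finset.card_insert_of_notMem (hmem i hi)]; omega) hy hyA hyB)
      (fun i hi y hy hyA hyB => ih (B := insert i B)
        (hdisj.mono_right (Finset.erase_subset _ _)) (hcard i hi) hAk hy hyA hyB) hx hA hB
    have ha1 := value_le_one (psd := psd) r m k
    have ha0 := value_nonneg (psd := psd) r m k
    have hab := value_le_succ (psd := psd) r m k
    have hm' : (0 : ℝ) < m := by exact_mod_cast hm
    have hX0 : 0 ≤ ∑ j ∈ R, x j.succ := Finset.sum_nonneg fun j _ => (hbox _).1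
    have hx0 : 0 ≤ x 0 := (hbox 0).1
    replace h1 := le_of_mul_le_mul_left h1 hm'
    rw [value_succ]
    push_cast
    set a := value psd r m k
    set b := value psd r m (k + 1)
    set X := ∑ j ∈ R, x j.succ
    have h3 : X ≤ (m + 1) * (b / (1 - a + b)) * x 0 := by
      rw [mul_right_comm, ← mul_div_assoc, le_div_iff₀ (by linarith)]
      linarith
    cases psd with
    | false => simpa [stepValue] using h3
    | true =>
      have h4 : X ≤ (m + 1) * ((1 + m * a) / (m + 1)) * x 0 := by
        rw [mul_div_cancel₀ _ (by positivity)]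
        rcases hX0.eq_or_lt with hz | hpos
        · rw [← hz]
          positivity
        · refine le_of_mul_le_mul_right ?_ hpos
          nlinarith [h2 rfl]
      simp only [stepValue, if_true]
      rcases min_choice (b / (1 - a + b)) ((1 + m * a) / (m + 1)) with e | e <;> rw [e]
      · exact h3
      · exact h4

end UpperBound

/-! ### Feasible points on faces -/

section LowerBound

variable {d : ℕ}

/-- The vector with `x₀ = 1`, equal to `1` on `A`, to `0` on `B`, and to `c` elsewhere. -/
def facePoint (A B : Finset (Fin d)) (c : ℝ) : Fin (d + 1) → ℝ :=
  Fin.cons 1 fun i => if i ∈ A then 1 else if i ∈ B then 0 else c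

@[simp] theorem facePoint_zero (A B : Finset (Fin d)) (c : ℝ) : facePoint A B c 0 = 1 := rfl

theorem facePoint_succ (A B : Finset (Fin d)) (c : ℝ) (i : Fin d) :
    facePoint A B c i.succ = if i ∈ A then 1 else if i ∈ B then 0 else c := rfl

/-- The symmetric lifting matrix whose diagonal is a face point. -/
def faceMatrix (x χ : Fin (d + 1) → ℝ) (c c' : ℝ) : Matrix (Fin (d + 1)) (Fin (d + 1)) ℝ :=
  -- On the free block, where `x = c` and `χ = 1`, the diagonal entries are `c` and the others `c
  -- c'`; elsewhere the matrix is `x xᵀ`.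
  Matrix.of fun p q => x p * x q + (c - c * c') * (if p = q then χ p else 0) +
    (c * c' - c ^ 2) * (χ p * χ q)

/-- Beyond `x xᵀ`, the free block has eigenvalue `c (1 - c')` orthogonally to `χ` and `c (1 + (m -
1) c' - m c)` along it, with `m` the size of `R`. -/
theorem posSemidef_faceMatrix (x : Fin (d + 1) → ℝ) (R : Finset (Fin d)) {c c' : ℝ}
    (hR : 0 < R.card) (hc : 0 ≤ c) (hc' : c' ≤ 1)
    (h : R.card * c ≤ 1 + (R.card - 1) * c') :
    (faceMatrix x (Fin.cons 0 fun i => if i ∈ R then 1 else 0) c c').PosSemidef := by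
  set χ : Fin (d + 1) → ℝ := Fin.cons 0 fun i => if i ∈ R then 1 else 0 with hχ
  refine .of_dotProduct_mulVec_nonneg (Matrix.IsHermitian.ext fun p q => ?_) fun w => ?_
  · simp only [faceMatrix, Matrix.of_apply, star_trivial, @eq_comm _ q p]
    split_ifs with hpq
    · rw [hpq]
    · ring
  · have e : star w ⬝ᵥ (faceMatrix x χ c c' *ᵥ w) = (w ⬝ᵥ x) ^ 2 +
        (c - c * c') * ∑ p, χ p * w p ^ 2 + (c * c' - c ^ 2) * (w ⬝ᵥ χ) ^ 2 := by
      have e1 : ∀ p, (faceMatrix x χ c c' *ᵥ w) p = x p * (w ⬝ᵥ x) + (c - c * c') * (χ p * w p)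
          + (c * c' - c ^ 2) * (χ p * (w ⬝ᵥ χ)) := by
        intro p
        simp only [faceMatrix, Matrix.mulVec, dotProduct, Matrix.of_apply, add_mul,
          Finset.sum_add_distrib, Finset.mul_sum, mul_ite, ite_mul, mul_zero, zero_mul,
          Finset.sum_ite_eq, Finset.mem_univ, if_true]
        congr 1
        · congr 1
          · exact Finset.sum_congr rfl fun q _ => by ring
          · ring
        · exact Finset.sum_congr rfl fun q _ => by ring
      rw [star_trivial, dotProduct]
      simp only [e1, mul_add, Finset.sum_add_distrib, sq (w ⬝ᵥ x), sq (w ⬝ᵥ χ)]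
      congr 1
      · congr 1
        · change _ = (∑ q, w q * x q) * (w ⬝ᵥ x)
          rw [Finset.sum_mul]
          exact Finset.sum_congr rfl fun q _ => by ring
        · rw [Finset.mul_sum]
          exact Finset.sum_congr rfl fun q _ => by ring
      · change _ = (c * c' - c ^ 2) * ((∑ q, w q * χ q) * (w ⬝ᵥ χ))
        rw [Finset.sum_mul, Finset.mul_sum]
        exact Finset.sum_congr rfl fun q _ => by ring
    have e2 : ∑ p, χ p * w p ^ 2 = ∑ i ∈ R, w i.succ ^ 2 := by
      simp [hχ, Fin.sum_univ_succ, Finset.sum_ite_mem]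
    have e3 : w ⬝ᵥ χ = ∑ i ∈ R, w i.succ := by
      simp [hχ, dotProduct, Fin.sum_univ_succ, Finset.sum_ite_mem]
    have hcs : (∑ i ∈ R, w i.succ) ^ 2 ≤ R.card * ∑ i ∈ R, w i.succ ^ 2 :=
      sq_sum_le_card_mul_sum_sq
    have hR' : (0 : ℝ) < R.card := by exact_mod_cast hR
    rw [e, e2, e3]
    set S := ∑ i ∈ R, w i.succ
    set T := ∑ i ∈ R, w i.succ ^ 2
    set m : ℝ := (R.card : ℝ)
    have h1 : 0 ≤ m * ((c - c * c') * T + (c * c' - c ^ 2) * S ^ 2) := by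
      have h2 : 0 ≤ c * (1 - c') * (m * T - S ^ 2) :=
        mul_nonneg (mul_nonneg hc (by linarith)) (by linarith)
      have h3 : 0 ≤ c * (1 + (m - 1) * c' - m * c) * S ^ 2 :=
        mul_nonneg (mul_nonneg hc (by linarith)) (sq_nonneg _)
      linarith
    have h4 := nonneg_of_mul_nonneg_right h1 hR'
    have := sq_nonneg (w ⬝ᵥ x)
    linarith

/-- A free column is `c` times a face point with `i` fixed to one; its complement is `1 - c` times
one with `i` fixed to zero and entry `c (1 - c') / (1 - c)`, at most `b` by `hb`. -/
theorem facePoint_mem_lift {psd : Bool} {K : Set (Fin (d + 1) → ℝ)} (hK : IsBoxCone K)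
    {A B R : Finset (Fin d)} (hAB : Disjoint A B) (hR : R = (A ∪ B)ᶜ) (hRne : R.Nonempty)
    {c c' b : ℝ} (hc : 0 ≤ c) (hc1 : c ≤ 1) (hc' : c' ≤ 1)
    (hb : c - c * c' ≤ (1 - c) * b)
    (hone : ∀ i ∈ R, c • facePoint (insert i A) B c' ∈ K)
    (hzero : ∀ i ∈ R, ∀ t, 0 ≤ t → t ≤ b → facePoint A (insert i B) t ∈ K)
    (hpsd : psd = true → R.card * c ≤ 1 + (R.card - 1) * c') :
    facePoint A B c ∈ lift psd K := by
  set x := facePoint A B c with hx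
  set χ : Fin (d + 1) → ℝ := Fin.cons 0 fun i => if i ∈ R then 1 else 0 with hχ
  have hRmem : ∀ i, i ∈ R ↔ i ∉ A ∧ i ∉ B := fun i => by simp [hR]
  have hBA : ∀ i ∈ B, i ∉ A := fun i hi hiA => Finset.disjoint_left.1 hAB hiA hi
  have hχ0 : χ 0 = 0 := rfl
  have hχs : ∀ i : Fin d, χ i.succ = if i ∈ R then 1 else 0 := fun _ => rfl
  have hxA : ∀ i ∈ A, x i.succ = 1 := fun i hi => by rw [hx, facePoint_succ, if_pos hi]
  have hxB : ∀ i ∈ B, x i.succ = 0 := fun i hi => by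
    rw [hx, facePoint_succ, if_neg (hBA i hi), if_pos hi]
  have hxR : ∀ i ∈ R, x i.succ = c := fun i hi => by
    rw [hx, facePoint_succ, if_neg ((hRmem i).1 hi).1, if_neg ((hRmem i).1 hi).2]
  have hx0 : x 0 = 1 := rfl
  have hcases : ∀ i, i ∈ A ∨ i ∈ B ∨ i ∈ R := fun i => by rw [hRmem]; tauto
  set Y := faceMatrix x χ c c'
  have hYapply : ∀ p q, Y p q = x p * x q + (c - c * c') * (if p = q then χ p else 0) +
    (c * c' - c ^ 2) * (χ p * χ q) := fun _ _ => rfl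
  have hYχ : ∀ p q, χ q = 0 → Y p q = x p * x q := fun p q hq => by
    rw [hYapply, hq]
    split_ifs with hpq
    · rw [hpq, hq]
      ring
    · ring
  have hχn : ∀ i, i ∉ R → χ i.succ = 0 := fun i hi => by rw [hχs, if_neg hi]
  have hχR : ∀ i ∈ R, χ i.succ = 1 := fun i hi => by rw [hχs, if_pos hi]
  have hAR : ∀ i ∈ A, i ∉ R := fun i hi h => ((hRmem i).1 h).1 hi
  have hBR : ∀ i ∈ B, i ∉ R := fun i hi h => ((hRmem i).1 h).2 hi
  have hYs : ∀ p q, Y p q = Y q p := fun p q => by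
    rw [hYapply, hYapply]
    by_cases hpq : p = q
    · rw [hpq]
    · rw [if_neg hpq, if_neg (Ne.symm hpq)]
      ring
  have hcol : ∀ i ∈ R, (fun q => Y q i.succ) = c • facePoint (insert i A) B c' := by
    intro i hi
    ext q
    rw [Pi.smul_apply, smul_eq_mul]
    refine Fin.cases ?_ (fun j => ?_) q
    · simp only [facePoint_zero]
      rw [hYs, hYχ _ _ hχ0, hxR i hi, hx0]
    · rw [facePoint_succ]
      rcases hcases j with hj | hj | hj
      · rw [if_pos (Finset.mem_insert_of_mem hj), hYs, hYχ _ _ (hχn _ (hAR j hj)), hxR i hi,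
          hxA j hj]
      · have hne : j ≠ i := fun h => hBR j hj (h ▸ hi)
        rw [if_neg (by simp [hne, hBA j hj]), if_pos hj, hYs, hYχ _ _ (hχn _ (hBR j hj)),
          hxB j hj, mul_zero, mul_zero]
      · rw [hYapply, hxR i hi, hxR j hj, hχR i hi, hχR j hj]
        by_cases hji : j = i
        · rw [if_pos (by rw [hji]), if_pos (by simp [hji])]
          ring
        · rw [if_neg (by simpa using hji), if_neg (by simp [hji, ((hRmem j).1 hj).1]),
            if_neg ((hRmem j).1 hj).2]
          ring
  have hcocol : ∀ i ∈ R, (fun q => x q - Y q i.succ) = Fin.cons (1 - c) (fun j =>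
      if j ∈ A then 1 - c else if j ∈ insert i B then 0 else c - c * c') := by
    intro i hi
    ext q
    have hq := congrFun (hcol i hi) q
    simp only [Pi.smul_apply, smul_eq_mul] at hq
    rw [hq]
    refine Fin.cases ?_ (fun j => ?_) q
    · rw [facePoint_zero, hx0, Fin.cons_zero, mul_one]
    · rw [facePoint_succ, Fin.cons_succ]
      rcases hcases j with hj | hj | hj
      · rw [hxA j hj, if_pos (Finset.mem_insert_of_mem hj), if_pos hj, mul_one]
      · have hne : j ≠ i := fun h => hBR j hj (h ▸ hi)
        rw [hxB j hj, if_neg (by simp [hne, hBA j hj]), if_pos hj, if_neg (hBA j hj),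
          if_pos (Finset.mem_insert_of_mem hj), mul_zero, sub_zero]
      · rw [hxR j hj, if_neg ((hRmem j).1 hj).1]
        by_cases hji : j = i
        · rw [if_pos (by simp [hji]), if_pos (by simp [hji])]
          ring
        · rw [if_neg (by simp [hji, ((hRmem j).1 hj).1]), if_neg ((hRmem j).1 hj).2,
            if_neg (by simp [hji, ((hRmem j).1 hj).2])]
  have hcoK : ∀ i ∈ R, (fun q => x q - Y q i.succ) ∈ K := by
    intro i hi
    rw [hcocol i hi]
    have hcc : 0 ≤ c - c * c' := by nlinarith
    rcases hc1.lt_or_eq with hlt | rfl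
    · have hpos : 0 < 1 - c := by linarith
      convert hK.smul_mem hpos.le (hzero i hi ((c - c * c') / (1 - c)) (by positivity)
        (by rw [div_le_iff₀ hpos]; linarith)) using 1
      ext q
      refine Fin.cases ?_ (fun j => ?_) q
      · simp
      · rw [Fin.cons_succ, Pi.smul_apply, facePoint_succ]
        split_ifs
        · simp
        · simp
        · rw [smul_eq_mul, mul_div_cancel₀ _ hpos.ne']
    -- At `c = 1` the hypothesis `hb` forces `c' = 1`, and the complementary column is zero.
    · convert hK.zero_mem using 1
      have : (1 : ℝ) - c' = 0 := by linarith
      ext q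
      refine Fin.cases ?_ (fun j => ?_) q
      · simp
      · simp [this]
  have hxK : x ∈ K := by
    obtain ⟨i, hi⟩ := hRne
    convert hK.add_mem ((hcol i hi).symm ▸ hone i hi) (hcoK i hi) using 1
    ext q
    simp
  refine (mem_lift_iff hK).2 ⟨Y, hYs, fun p => ?_, fun p => ?_, fun p => ?_, fun p => ?_,
    fun h => posSemidef_faceMatrix x R hRne.card_pos hc hc' (hpsd h)⟩
  · rw [hYχ _ _ hχ0, hx0, mul_one]
  · refine Fin.cases ?_ (fun j => ?_) p
    · rw [hYχ _ _ hχ0, hx0, mul_one]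
    · rcases hcases j with hj | hj | hj
      · rw [hYχ _ _ (hχn _ (hAR j hj)), hxA j hj, mul_one]
      · rw [hYχ _ _ (hχn _ (hBR j hj)), hxB j hj, mul_zero]
      · rw [hYapply, hxR j hj, hχR j hj, if_pos rfl]
        ring
  · refine Fin.cases ?_ (fun j => ?_) p
    · simpa [hYχ _ _ hχ0, hx0] using hxK
    · rcases hcases j with hj | hj | hj
      · simpa [hYχ _ _ (hχn _ (hAR j hj)), hxA j hj] using hxK
      · simpa [hYχ _ _ (hχn _ (hBR j hj)), hxB j hj] using! hK.zero_mem
      · rw [hcol j hj]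
        exact hone j hj
  · refine Fin.cases ?_ (fun j => ?_) p
    · simpa [hYχ _ _ hχ0, hx0] using! hK.zero_mem
    · rcases hcases j with hj | hj | hj
      · simpa [hYχ _ _ (hχn _ (hAR j hj)), hxA j hj] using! hK.zero_mem
      · simpa [hYχ _ _ (hχn _ (hBR j hj)), hxB j hj] using hxK
      · exact hcoK j hj

/-- A `0`-`1` vector of a box cone belongs to its lift. -/
theorem zeroOne_mem_lift {psd : Bool} {K : Set (Fin (d + 1) → ℝ)} (hK : IsBoxCone K)
    {x : Fin (d + 1) → ℝ} (hx : x ∈ K) (h0 : x 0 = 1)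
    (h1 : ∀ i : Fin d, x i.succ = 0 ∨ x i.succ = 1) :
    x ∈ lift psd K := by
  have h : ∀ p, x p = 0 ∨ x p = 1 := fun p => by
    refine Fin.cases (Or.inr h0) (fun i => h1 i) p
  refine (mem_lift_iff hK).2 ⟨Matrix.vecMulVec x x, fun p q => ?_, fun p => ?_, fun p => ?_,
    fun p => ?_, fun p => ?_, fun _ => ?_⟩
  · simp [Matrix.vecMulVec_apply, mul_comm]
  · simp [Matrix.vecMulVec_apply, h0]
  · rcases h p with e | e <;> simp [Matrix.vecMulVec_apply, e]
  · rcases h p with e | e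
    · simpa [Matrix.vecMulVec_apply, e] using! hK.zero_mem
    · simpa [Matrix.vecMulVec_apply, e] using hx
  · rcases h p with e | e
    · simpa [Matrix.vecMulVec_apply, e] using hx
    · simpa [Matrix.vecMulVec_apply, e] using! hK.zero_mem
  · simpa using Matrix.posSemidef_vecMulVec_self_star x

/-- The lower bound on faces of the iterates. -/
theorem facePoint_mem_liftIter {psd : Bool} {h : ℕ} (hd : 0 < d) (r : ℕ) {A B R : Finset (Fin d)}
    {m k : ℕ} (hAB : Disjoint A B) (hR : R = (A ∪ B)ᶜ) (hm : R.card = m) (hAk : A.card + k = h)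
    {c : ℝ} (hc : 0 ≤ c) (hcv : c ≤ value psd r m k) :
    facePoint A B c ∈ liftIter psd r (cardinalityCone d h) := by
  have hc1 : c ≤ 1 := hcv.trans (value_le_one _ _ _)
  induction r generalizing A B R m k c with
  | zero =>
    refine ⟨fun S hS => ?_, fun i => ?_⟩
    · have hA' : (((S ∩ A).card : ℕ) : ℝ) ≤ A.card := by
        exact_mod_cast Finset.card_le_card Finset.inter_subset_right
      have hR' : ((S ∩ R).card : ℝ) ≤ m := by
        rw [← hm]
        exact_mod_cast Finset.card_le_card Finset.inter_subset_right
      have hS' : ((S ∩ A).card : ℝ) + (S ∩ R).card ≤ h + 1 := by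
        have hdis : Disjoint (S ∩ A) (S ∩ R) := by
          rw [Finset.disjoint_left]
          intro i hi hi'
          simp only [Finset.mem_inter, hR, Finset.mem_compl, Finset.mem_union] at hi hi'
          tauto
        have := Finset.card_le_card (Finset.union_subset
          (Finset.inter_subset_left (s₁ := S) (s₂ := A))
          (Finset.inter_subset_left (s₁ := S) (s₂ := R)))
        rw [Finset.card_union_of_disjoint hdis, hS] at this
        exact_mod_cast this
      have e : ∑ i ∈ S, facePoint A B c i.succ = (S ∩ A).card + c * (S ∩ R).card := by
        have : ∀ i ∈ S, facePoint A B c i.succ =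
            (if i ∈ A then (1 : ℝ) else 0) + if i ∈ R then c else 0 := by
          intro i _
          rw [facePoint_succ]
          by_cases h1 : i ∈ A <;> by_cases h2 : i ∈ B <;> simp [hR, h1, h2]
        rw [Finset.sum_congr rfl this, Finset.sum_add_distrib, Finset.sum_ite_mem,
          Finset.sum_ite_mem]
        simp [mul_comm]
      rw [e, facePoint_zero, mul_one, ← hAk]
      push_cast
      have hAk' : (A.card : ℝ) + k = h := by exact_mod_cast hAk
      by_cases hmk : m ≤ k
      · have : (m : ℝ) ≤ k := by exact_mod_cast hmk
        nlinarith
      · obtain ⟨m, rfl⟩ : ∃ l, m = l + 1 := ⟨m - 1, by omega⟩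
        have hck : c * (k + 1) ≤ k := by
          rcases k with _ | k
          · simpa using hcv
          · rw [value_zero_round, if_neg (by omega), le_div_iff₀ (by positivity)] at hcv
            push_cast
            linarith
        -- Since `c ≤ 1`, the worst `S` contains all of `A` and `k + 1` free elements.
        nlinarith [mul_le_mul_of_nonneg_left hS' hc,
          mul_le_mul_of_nonneg_left hA' (sub_nonneg.2 hc1)]
    · rw [facePoint_succ, facePoint_zero]
      split_ifs <;> simp [hc, hc1]
  | succ r ih =>
    have hK := (isBoxCone_cardinalityCone hd h).liftIter (psd := psd) r
    rcases m with _ | m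
    · refine zeroOne_mem_lift hK (ih hAB hR hm hAk hc (by simpa using hc1) hc1) rfl fun i => ?_
      have : i ∈ A ∪ B := by
        by_contra hi
        rw [Finset.card_eq_zero.1 hm] at hR
        exact absurd (Finset.mem_compl.2 hi) (hR ▸ Finset.notMem_empty i)
      rw [facePoint_succ]
      split_ifs with h1 h2
      · simp
      · simp
      · rw [Finset.mem_union] at this
        tauto
    rcases k with _ | k
    · rw [value_zero_capacity] at hcv
      obtain rfl : c = 0 := le_antisymm hcv hc
      refine zeroOne_mem_lift hK (ih hAB hR hm hAk hc (by simp) hc1) rfl fun i => ?_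
      rw [facePoint_succ]
      split_ifs <;> simp
    have hmemR : ∀ i ∈ R, i ∉ A ∧ i ∉ B := fun i hi => by simpa [hR] using hi
    have hcard : ∀ i ∈ R, (R.erase i).card = m := fun i hi => by
      rw [Finset.card_erase_of_mem hi, hm]
      rfl
    have ha1 := value_le_one (psd := psd) r m k
    have ha0 := value_nonneg (psd := psd) r m k
    have hab := value_le_succ (psd := psd) r m k
    rw [value_succ] at hcv
    refine facePoint_mem_lift hK hAB hR (Finset.card_pos.1 (by omega)) hc hc1 ha1
      (b := value psd r m (k + 1)) ?_ (fun i hi => ?_) (fun i hi t ht htb => ?_) fun hp => ?_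
    · have := hcv.trans (stepValue_le_div m _ _)
      rw [le_div_iff₀ (by linarith)] at this
      linarith
    · refine hK.smul_mem hc (ih (R := R.erase i) ?_ ?_ (hcard i hi) ?_ ha0 le_rfl ha1)
      · exact Finset.disjoint_insert_left.2 ⟨(hmemR i hi).2, hAB⟩
      · ext j
        simp [hR]
      · rw [Finset.card_insert_of_notMem (hmemR i hi).1]
        omega
    · refine ih (R := R.erase i) ?_ ?_ (hcard i hi) hAk ht htb (htb.trans (value_le_one _ _ _))
      · exact Finset.disjoint_insert_right.2 ⟨(hmemR i hi).1, hAB⟩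
      · ext j
        simp [hR]
    · subst hp
      simp only [stepValue, if_true] at hcv
      have := hcv.trans (min_le_right _ _)
      rw [le_div_iff₀ (by positivity)] at this
      rw [hm]
      push_cast
      linarith

end LowerBound

/-! ### Optimal values and valid inequalities -/

section Ranks

variable {d : ℕ}

theorem sum_le_of_mem {psd : Bool} (hd : 0 < d) (h r : ℕ) {x : Fin (d + 1) → ℝ}
    (hx : x ∈ liftIter psd r (cardinalityCone d h)) :
    ∑ i : Fin d, x i.succ ≤ d * value psd r d h * x 0 :=
  face_sum_le hd r (A := ∅) (B := ∅) (by simp) (by simp) (by simp) hx (by simp) (by simp)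

theorem constant_mem_liftIter {psd : Bool} (hd : 0 < d) (h r : ℕ) :
    facePoint ∅ ∅ (value psd r d h) ∈ liftIter psd r (cardinalityCone d h) :=
  facePoint_mem_liftIter hd r (R := Finset.univ) (m := d) (k := h) (by simp) (by simp) (by simp)
    (by simp) (value_nonneg _ _ _) le_rfl

theorem isGreatest_sumValues {psd : Bool} (hd : 0 < d) (h r : ℕ) :
    IsGreatest (sumValues (liftIter psd r (cardinalityCone d h))) (d * value psd r d h) := by
  refine ⟨⟨_, constant_mem_liftIter hd h r, rfl, by simp [facePoint_succ]⟩, ?_⟩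
  rintro _ ⟨x, hx, h0, rfl⟩
  simpa [h0] using sum_le_of_mem hd h r hx

theorem valid_liftIter_iff {psd : Bool} (hd : 0 < d) (h r : ℕ) :
    Valid (liftIter psd r (cardinalityCone d h)) (fun _ => 1) (h : ℝ) ↔
      d * value psd r d h ≤ h := by
  constructor
  · intro hv
    simpa [facePoint_succ] using hv _ (constant_mem_liftIter hd h r)
  · intro hv x hx
    have := (isBoxCone_cardinalityCone hd h).box (liftIter_subset
      (isBoxCone_cardinalityCone hd h) r hx) 0
    simpa using (sum_le_of_mem hd h r hx).trans (mul_le_mul_of_nonneg_right hv this.1)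

/-- A `0`-`1` vector with more than `h` ones has `h + 1` of them, violating a defining constraint.
-/
theorem valid_integerCone (h : ℕ) :
    Valid (integerCone (cardinalityCone d h)) (fun _ => 1) (h : ℝ) := by
  intro x hx
  refine Submodule.span_induction
    (p := fun x _ => ∑ i : Fin d, 1 * x i.succ ≤ (h : ℝ) * x 0) ?_ ?_ ?_ ?_ hx
  · rintro x ⟨⟨hS, -⟩, h0, h1⟩
    have e : ∀ T : Finset (Fin d), (∀ i ∈ T, x i.succ = 1) → ∑ i ∈ T, x i.succ = T.card :=
      fun T hT => by rw [Finset.sum_congr rfl hT]; simp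
    let T : Finset (Fin d) := Finset.univ.filter fun i => x i.succ = 1
    have hT : ∑ i : Fin d, 1 * x i.succ = T.card := by
      rw [← e T fun i hi => (Finset.mem_filter.1 hi).2, Finset.sum_filter]
      refine Finset.sum_congr rfl fun i _ => ?_
      rcases h1 i with h | h <;> simp [h]
    rw [hT, h0, mul_one]
    by_contra! hlt
    obtain ⟨S, hST, hSc⟩ := Finset.exists_subset_card_eq (Nat.succ_le_of_lt (Nat.cast_lt.1 hlt))
    have := hS S hSc
    rw [e S fun i hi => (Finset.mem_filter.1 (hST hi)).2, hSc, h0] at this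
    push_cast at this
    linarith
  · simp
  · intro x y _ _ hx hy
    simp only [Pi.add_apply, mul_add, Finset.sum_add_distrib] at hx hy ⊢
    linarith
  · intro t x _ hx
    have := mul_le_mul_of_nonneg_left hx t.2
    rw [Finset.mul_sum] at this
    simp only [one_mul] at this ⊢
    change ∑ i : Fin d, (t : ℝ) * x i.succ ≤ (h : ℝ) * ((t : ℝ) * x 0)
    linarith

theorem not_mul_value_le_iff {psd : Bool} {h r : ℕ} (hd : 0 < d) :
    ¬ (d * value psd r d h ≤ h) ↔ (h : ℝ) / d < value psd r d h := by
  have hd' : (0 : ℝ) < d := by exact_mod_cast hd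
  rw [not_le, div_lt_iff₀ hd', mul_comm]

end Ranks

end LiftProject

theorem mainTheorem2 (d : ℕ) (hd : Even d) (hd2 : 2 ≤ d) :
    LiftProject.HasNRank (LiftProject.halfCone d) (fun _ => 1) ((d : ℝ) / 2) (d - 2) ∧
    (4 ≤ d →
      LiftProject.HasNPlusRank (LiftProject.halfCone d) (fun _ => 1) ((d : ℝ) / 2) (d / 2)) ∧
    (∀ r : ℕ, (r : ℝ) ≤ (d : ℝ) / 2 - Real.sqrt (d : ℝ) + 3 / 2 →
      ∃ m : ℝ,
        IsGreatest (LiftProject.sumValues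
          (LiftProject.NIter r (LiftProject.halfCone d))) m ∧
        IsGreatest (LiftProject.sumValues
          (LiftProject.NPlusIter r (LiftProject.halfCone d))) m) := by
  open LiftProject in
  obtain ⟨h, hh⟩ := hd
  have hdh : d = 2 * h := by omega
  have hd0 : 0 < d := by omega
  have hdr : (d : ℝ) = 2 * h := by exact_mod_cast hdh
  have e2 : (d : ℝ) / 2 = h := by rw [hdr]; ring
  rw [halfCone_eq_cardinalityCone hdh, e2]
  simp only [HasNRank, HasNPlusRank, NIter_eq_liftIter, NPlusIter_eq_liftIter]
  refine ⟨⟨valid_integerCone h, (valid_liftIter_iff hd0 h _).2 ?_, fun r hr => ?_⟩,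
    fun hd4 => ⟨valid_integerCone h, (valid_liftIter_iff hd0 h _).2 ?_, fun r hr => ?_⟩,
    fun r hr => ⟨d * value false r d h, isGreatest_sumValues hd0 h r, ?_⟩⟩
  · have := value_false_eq_ratio (m := d - 2) (k := h) (by omega)
    rw [show d - 2 + 2 = d by omega] at this
    have hc : ((d - 2 : ℕ) : ℝ) + 2 = d := by exact_mod_cast (by omega : d - 2 + 2 = d)
    rw [this, hc, mul_div_cancel₀ _ (by positivity)]
  · by_contra! hlt
    exact (not_mul_value_le_iff hd0).2 (ratio_lt_value_false (by omega) (by omega) (by omega))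
      ((valid_liftIter_iff hd0 h r).1 hr)
  · exact value_true_le_ratio (by omega) (by omega)
  · by_contra! hlt
    exact (not_mul_value_le_iff hd0).2 (ratio_lt_value_true (by omega) (by omega))
      ((valid_liftIter_iff hd0 h r).1 hr)
  · suffices value false r d h = value true r d h by
      rw [this]
      exact isGreatest_sumValues hd0 h r
    have hs := Real.sq_sqrt (Nat.cast_nonneg (α := ℝ) d)
    have hs0 := Real.sqrt_nonneg (d : ℝ)
    -- For `d = 2` the range includes `r = 1 = h`, where the closed form is unavailable, so the
    -- values are computed directly.
    rcases Nat.lt_or_ge h 2 with h1 | h1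
    · obtain rfl : h = 1 := by omega
      obtain rfl : d = 2 := hdh
      have hr2 : r < 2 := by
        have : (r : ℝ) < 2 := by
          have : 1 / 2 < Real.sqrt ((2 : ℕ) : ℝ) := Real.lt_sqrt_of_sq_lt (by norm_num)
          push_cast at *
          linarith
        exact_mod_cast this
      interval_cases r
      · simp [value]
      · norm_num [value, stepValue]
    · have h2 : 2 ≤ Real.sqrt (d : ℝ) := Real.le_sqrt_of_sq_le (by
        rw [hdr]
        have : (2 : ℝ) ≤ h := by exact_mod_cast h1
        linarith)
      have hrh : r < h := by
        have : (r : ℝ) < h := by linarith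
        exact_mod_cast this
      -- Here `h + 2 - r ≥ √d + 1/2` and `h + 1 - r ≥ √d - 1/2`, with product at least `d - 1/4 ≥ d
      -- - 1`.
      refine (value_true_eq_false (by omega) (by omega) ?_).symm
      rw [hdr]
      nlinarith
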